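/- For a bounded Lipschitz domain $\Omega\subset\mathbb R^2$ let $$T(\Omega)=\inf\Big\{\tfrac12\int_\Omega|\nabla u|^2\,dx-\int_\Omega u\,dx:\ u\in H^1(\Omega),\ \int_{\partial\Omega}u\,d\sigma=0\Big\},$$ where $\sigma$ is arc length and the boundary values of $u$ are taken in the sense of traces. For each integer $N\ge 3$ let $P_N\subset\mathbb R^2$ be an open regular $N$-gon of area $\pi$ (in any position), with center $c_N$ and perimeter $P(P_N)$, and let $B$ be the open unit disk centered at the origin. Then: 1. $T(P_N)$ is strictly increasing in $N\ge 3$. 2. $\lim_{N\to\infty}T(P_N)=T(B)$. 3. $T(P_N)<T(B)$ for every $N\ge 3$. 4. $B$ is not a local minimizer of $T$ under Lipschitz volume-preserving perturbations: for every $\varepsilon>0$ there is a vector field $V:\mathbb R^2\to\mathbb R^2$ with $|V|\le\varepsilon$ everywhere and Lipschitz constant at most $\varepsilon$ such that $|(\mathrm{id}+V)(B)|=|B|$ and $T((\mathrm{id}+V)(B))<T(B)$. 5. For every $N\ge3$ the infimum defining $T(P_N)$ is attained by $$u(x)=\frac1{4P(P_N)}\int_{\partial P_N}|y-c_N|^2\,d\sigma(y)-\frac{|x-c_N|^2}{4}.$$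 6. For every $N\ge3$, $$T(P_N)=-\frac{\pi^2\,\big(3+\tan^2(\pi/N)\big)}{48\,N\tan(\pi/N)}.$$ -/

import Mathlib

open MeasureTheory Filter Topology
open scoped ENNReal NNReal ContDiff

namespace BoundaryMeanTorsion

/-- The Euclidean plane. -/
abbrev Plane : Type := EuclideanSpace ℝ (Fin 2)

/-- Arc length `σ` on the boundary of `Ω`: one-dimensional Hausdorff measure on the frontier. -/
noncomputable def boundaryMeasure (Ω : Set Plane) : Measure Plane :=
  (Measure.hausdorffMeasure 1).restrict (frontier Ω)

/-- The perimeter of `Ω`. -/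
noncomputable def perimeter (Ω : Set Plane) : ℝ :=
  (boundaryMeasure Ω).real Set.univ

/-- `u ∈ H¹(Ω)`, with weak gradient `G`: both are square integrable on `Ω` and
`∫_Ω u ∇ψ = - ∫_Ω ψ G` for every test function `ψ ∈ C_c^∞(Ω)`. -/
structure IsSobolev (Ω : Set Plane) (u : Plane → ℝ) (G : Plane → Plane) : Prop where
  memLp : MemLp u 2 (volume.restrict Ω)
  memLp_grad : MemLp G 2 (volume.restrict Ω)
  weak_grad : ∀ ψ : Plane → ℝ, ContDiff ℝ ∞ ψ → HasCompactSupport ψ → tsupport ψ ⊆ Ω →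
    ∫ x in Ω, u x • gradient ψ x = - ∫ x in Ω, ψ x • G x

/-- `g ∈ L²(∂Ω)` is the boundary trace of the Sobolev function `u` with weak gradient `G`:
there are smooth functions `φ k` on the plane that converge to `u` in `H¹(Ω)` and
whose restrictions to the boundary converge to `g` in `L²(∂Ω)`. On a bounded Lipschitz domain
every `u ∈ H¹(Ω)` has exactly one trace in this sense, up to null sets. -/
structure IsTrace (Ω : Set Plane) (u : Plane → ℝ) (G : Plane → Plane) (g : Plane → ℝ) :
    Prop where
  memLp : MemLp g 2 (boundaryMeasure Ω)
  exists_approx : ∃ φ : ℕ → Plane → ℝ, (∀ k, ContDiff ℝ ∞ (φ k)) ∧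
    Tendsto (fun k => eLpNorm (fun x => φ k x - u x) 2 (volume.restrict Ω)) atTop (𝓝 0) ∧
    Tendsto (fun k => eLpNorm (fun x => gradient (φ k) x - G x) 2 (volume.restrict Ω))
      atTop (𝓝 0) ∧
    Tendsto (fun k => eLpNorm (fun x => φ k x - g x) 2 (boundaryMeasure Ω)) atTop (𝓝 0)

/-- The competitors: `u ∈ H¹(Ω)` (with weak gradient `G`) such that `∫_{∂Ω} u dσ = 0`. -/
def IsAdmissible (Ω : Set Plane) (u : Plane → ℝ) (G : Plane → Plane) : Prop :=
  IsSobolev Ω u G ∧ ∃ g : Plane → ℝ, IsTrace Ω u G g ∧ ∫ x, g x ∂(boundaryMeasure Ω) = 0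

/-- `½ ∫_Ω |∇u|² - ∫_Ω u`, where `G` is the weak gradient of `u`. -/
noncomputable def energy (Ω : Set Plane) (u : Plane → ℝ) (G : Plane → Plane) : ℝ :=
  (1 / 2) * (∫ x in Ω, ‖G x‖ ^ 2) - ∫ x in Ω, u x

/-- The torsion energy with boundary mean zero condition,
`T(Ω) = inf {½ ∫_Ω |∇u|² - ∫_Ω u : u ∈ H¹(Ω), ∫_{∂Ω} u dσ = 0}`, as an extended real number. -/
noncomputable def T (Ω : Set Plane) : EReal :=
  ⨅ (u : Plane → ℝ) (G : Plane → Plane) (_ : IsAdmissible Ω u G), (energy Ω u G : EReal)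

/-- `u` attains the infimum in the definition of `T(Ω)`. -/
def IsMinimizer (Ω : Set Plane) (u : Plane → ℝ) : Prop :=
  ∃ G : Plane → Plane, IsAdmissible Ω u G ∧ (energy Ω u G : EReal) = T Ω

/-- `S` is an (open) regular `N`-gon with center `c`, of arbitrary size and orientation: the
interior of the convex hull of `N` equally spaced points on a circle about `c`. -/
def IsRegularPolygon (N : ℕ) (c : Plane) (S : Set Plane) : Prop :=
  ∃ R θ : ℝ, 0 < R ∧
    S = interior (convexHull ℝ (Set.range fun k : Fin N =>
      c + R • (!₂[Real.cos (θ + 2 * Real.pi * (k : ℝ) / (N : ℝ)),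
        Real.sin (θ + 2 * Real.pi * (k : ℝ) / (N : ℝ))] : Plane)))

/-- `Ω` is a local minimizer of the shape functional `F` under Lipschitz volume-preserving
perturbations: `F(Ω) ≤ F((id + V)(Ω))` for all vector fields `V` which are small in the
Lipschitz norm and for which `(id + V)(Ω)` has the same area as `Ω`. (If the Lipschitz constant of
`V` is below `1`, then `id + V` is a bi-Lipschitz homeomorphism of the plane.) -/
def IsLipschitzLocalMinimizer (F : Set Plane → EReal) (Ω : Set Plane) : Prop :=
  ∃ ε : ℝ≥0, 0 < ε ∧ ∀ V : Plane → Plane, LipschitzWith ε V → (∀ x, ‖V x‖ ≤ ε) →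
    volume ((fun x => x + V x) '' Ω) = volume Ω → F Ω ≤ F ((fun x => x + V x) '' Ω)

end BoundaryMeanTorsion

/-! On a regular polygon with center `c` and apothem `r` the quantity `⟨x - c, ν⟩` equals `r` on
every side, so the divergence theorem for the field `φ (x - c)` reads `∫_Ω (⟨x - c, ∇φ⟩ + 2 φ) = r
∫_{∂Ω} φ dσ`. This is `RadialIdentity`; the unit disk satisfies it as well. For a competitor `u` the
right side vanishes, hence `-∫ u = ½ ∫ ⟨x - c, ∇u⟩`, and completing the square turns the energy into
`½ ∫ |∇u + (x - c)/2|² - ⅛ ∫ |x - c|²`. The square vanishes for `u = const - |x - c|²/4`, and the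
constant is free to make the boundary mean zero. So `T(Ω) = -⅛ ∫_Ω |x - c|²`
(`RadialIdentity.T_eq`).

The second moment comes from the same identity with `φ = |x - c|²`, and the area from `φ = 1`. For
area `π` and `x = π/N` the value is `-(π/48) x (3 + tan² x) / tan x`. The function of `x` increases
strictly on `(0, π/2)` and tends to `3` at `0`, which gives monotonicity, the limit `-π/16 = T(B)`
and the strict inequality.

For the failure of local minimality, the disk is stretched radially onto the polygon of the same
area. The radius of the polygon as a function of direction is uniformly close to `1` and also has a
Lipschitz constant of order `1/N`, because each direction is within angle `π/N` of a side normal. So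
the displacement is small in Lipschitz norm, while the energy drops. -/

namespace BoundaryMeanTorsion

/-! ### Monotonicity and limit of the explicit values. -/

/-- The value of `r² (3 + tan² x)` when an `N`-gon, `x = π / N`, with apothem `r` has area `π`. -/
noncomputable def tanRatio (x : ℝ) : ℝ := x * (3 + Real.tan x ^ 2) / Real.tan x

/-- The difference of the two sides vanishes at `0` and has derivative `2 sin z (z - sin z) > 0`.
With `y = 2x` it controls the sign of the derivative of `tanRatio`. -/
lemma mul_one_add_two_cos_lt {y : ℝ} (h0 : 0 < y) (hy : y < Real.pi) :
    y * (1 + 2 * Real.cos y) < Real.sin y * (2 + Real.cos y) := by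
  let F : ℝ → ℝ := fun y => Real.sin y * (2 + Real.cos y) - y * (1 + 2 * Real.cos y)
  have hd : ∀ z, HasDerivAt F (2 * Real.sin z * (z - Real.sin z)) z := by
    intro z
    have h1 := ((Real.hasDerivAt_sin z).mul ((Real.hasDerivAt_cos z).const_add 2)).sub
      ((hasDerivAt_id z).mul (((Real.hasDerivAt_cos z).const_mul 2).const_add 1))
    refine HasDerivAt.congr_deriv h1 ?_
    simp only [id]
    nlinarith [Real.sin_sq_add_cos_sq z]
  have hm : StrictMonoOn F (Set.Icc 0 Real.pi) := by
    apply strictMonoOn_of_deriv_pos (convex_Icc _ _)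
    · exact fun z _ => (hd z).continuousAt.continuousWithinAt
    · intro z hz
      rw [interior_Icc] at hz
      rw [(hd z).deriv]
      have := Real.sin_pos_of_pos_of_lt_pi hz.1 hz.2
      have := Real.sin_lt hz.1
      apply mul_pos <;> linarith
  have := hm ⟨le_rfl, Real.pi_pos.le⟩ ⟨h0.le, hy.le⟩ h0
  simp only [F, Real.sin_zero] at this
  linarith

lemma tanRatio_strictMonoOn : StrictMonoOn tanRatio (Set.Ioo 0 (Real.pi / 2)) := by
  have hd : ∀ x ∈ Set.Ioo 0 (Real.pi / 2), HasDerivAt tanRatio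
      ((((1 * (3 + Real.tan x ^ 2) + x * (2 * Real.tan x * (1 / Real.cos x ^ 2))) * Real.tan x
        - x * (3 + Real.tan x ^ 2) * (1 / Real.cos x ^ 2)) / Real.tan x ^ 2)) x := by
    intro x hx
    have hc : 0 < Real.cos x := Real.cos_pos_of_mem_Ioo ⟨by linarith [hx.1, Real.pi_pos], hx.2⟩
    have ht : 0 < Real.tan x := Real.tan_pos_of_pos_of_lt_pi_div_two hx.1 hx.2
    have h1 := Real.hasDerivAt_tan hc.ne'
    have h2 := ((hasDerivAt_id x).mul ((h1.pow 2).const_add 3)).div h1 ht.ne'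
    refine HasDerivAt.congr_deriv h2 ?_
    simp
  apply strictMonoOn_of_deriv_pos (convex_Ioo _ _)
  · exact fun z hz => (hd z hz).continuousAt.continuousWithinAt
  · intro x hx
    rw [interior_Ioo] at hx
    rw [(hd x hx).deriv]
    have hc : 0 < Real.cos x := Real.cos_pos_of_mem_Ioo ⟨by linarith [hx.1, Real.pi_pos], hx.2⟩
    have hs : 0 < Real.sin x := Real.sin_pos_of_pos_of_lt_pi hx.1 (by linarith [hx.2, hx.1])
    have ht : 0 < Real.tan x := Real.tan_pos_of_pos_of_lt_pi_div_two hx.1 hx.2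
    apply div_pos _ (by positivity)
    have key := mul_one_add_two_cos_lt (y := 2 * x) (by linarith [hx.1]) (by linarith [hx.2])
    rw [Real.tan_eq_sin_div_cos, Real.cos_two_mul, Real.sin_two_mul] at *
    have hsc := Real.sin_sq_add_cos_sq x
    generalize Real.sin x = s at *
    generalize Real.cos x = c at *
    -- Here `s c (3c² + s²) - x (3c² - s²)` is half the difference in `key`, by the double angle
    -- formulas.
    have e : ((1 * (3 + (s / c) ^ 2) + x * (2 * (s / c) * (1 / c ^ 2))) * (s / c)
        - x * (3 + (s / c) ^ 2) * (1 / c ^ 2)) =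
        (s * c * (3 * c ^ 2 + s ^ 2) - x * (3 * c ^ 2 - s ^ 2)) / c ^ 4 := by
      field_simp
      ring
    rw [e]
    apply div_pos _ (by positivity)
    have hs2 : s ^ 2 = 1 - c ^ 2 := by linarith
    rw [hs2]
    nlinarith

lemma tendsto_tan_div : Tendsto (fun x => Real.tan x / x) (𝓝[≠] 0) (𝓝 1) := by
  have h := Real.hasDerivAt_tan (x := 0) (by simp)
  rw [hasDerivAt_iff_tendsto_slope] at h
  simpa [slope_fun_def_field] using h

lemma tendsto_tanRatio : Tendsto tanRatio (𝓝[≠] 0) (𝓝 3) := by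
  have h1 : Tendsto Real.tan (𝓝[≠] 0) (𝓝 0) := by
    have := (Real.hasDerivAt_tan (x := 0) (by simp)).continuousAt.tendsto
    rw [Real.tan_zero] at this
    exact this.mono_left nhdsWithin_le_nhds
  have h2 := ((h1.pow 2).const_add 3).mul (tendsto_tan_div.inv₀ one_ne_zero)
  simp only [ne_eq, OfNat.ofNat_ne_zero, not_false_eq_true, zero_pow, add_zero, inv_one,
    mul_one] at h2
  refine h2.congr fun x => ?_
  simp only [tanRatio, inv_div]
  ring

lemma pi_div_tendsto : Tendsto (fun N : ℕ => Real.pi / N) atTop (𝓝[≠] 0) := by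
  rw [tendsto_nhdsWithin_iff]
  refine ⟨tendsto_const_div_atTop_nhds_zero_nat _, ?_⟩
  filter_upwards [eventually_gt_atTop 0] with N hN
  have : (0 : ℝ) < N := by exact_mod_cast hN
  exact (div_pos Real.pi_pos this).ne'

lemma pi_div_mem {N : ℕ} (hN : 3 ≤ N) : Real.pi / N ∈ Set.Ioo 0 (Real.pi / 2) := by
  have : (3 : ℝ) ≤ N := by exact_mod_cast hN
  constructor
  · have := Real.pi_pos; positivity
  · have := Real.pi_pos
    rw [div_lt_div_iff₀ (by linarith) (by norm_num)]
    nlinarith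

/-- The value of the torsion energy of the regular `N`-gon of area `π`. -/
noncomputable def polygonValue (N : ℕ) : ℝ :=
  -(Real.pi ^ 2 * (3 + Real.tan (Real.pi / N) ^ 2) / (48 * N * Real.tan (Real.pi / N)))

lemma polygonValue_eq (N : ℕ) : polygonValue N = -(Real.pi / 48) * tanRatio (Real.pi / N) := by
  rw [polygonValue, tanRatio, mul_assoc (48 : ℝ), ← div_div, ← div_div]
  ring

lemma polygonValue_strictMonoOn : StrictMonoOn polygonValue (Set.Ici 3) := by
  intro a ha b hb hab
  rw [polygonValue_eq, polygonValue_eq]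
  have h : Real.pi / b < Real.pi / a := by
    have h3 : (3 : ℝ) ≤ a := by exact_mod_cast (show 3 ≤ a from ha)
    have h4 : (a : ℝ) < b := by exact_mod_cast hab
    exact div_lt_div_of_pos_left Real.pi_pos (by linarith) h4
  have := tanRatio_strictMonoOn (pi_div_mem hb) (pi_div_mem ha) h
  nlinarith [Real.pi_pos]

lemma tendsto_polygonValue : Tendsto polygonValue atTop (𝓝 (-(Real.pi / 16))) := by
  have h := (tendsto_tanRatio.comp pi_div_tendsto).const_mul (-(Real.pi / 48))
  have e : -(Real.pi / 48) * 3 = -(Real.pi / 16) := by ring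
  rw [e] at h
  exact h.congr fun N => (polygonValue_eq N).symm

lemma polygonValue_lt {N : ℕ} (hN : 3 ≤ N) : polygonValue N < -(Real.pi / 16) := by
  -- Passing through `N + 1` keeps the inequality with the limit strict.
  refine (polygonValue_strictMonoOn hN (show 3 ≤ N + 1 by omega) (Nat.lt_succ_self N)).trans_le ?_
  refine ge_of_tendsto tendsto_polygonValue ?_
  filter_upwards [eventually_ge_atTop (N + 1)] with M hM
  exact polygonValue_strictMonoOn.monotoneOn (show 3 ≤ N + 1 by omega) (show 3 ≤ M by omega) hM

/-! ### The radial identity and the explicit minimizer. -/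

/-- The identity `∫_Ω (⟨x - c, ∇φ⟩ + 2 φ) = κ ∫_{∂Ω} φ dσ` for all smooth functions `φ`. -/
def RadialIdentity (Ω : Set Plane) (c : Plane) (κ : ℝ) : Prop :=
  ∀ φ : Plane → ℝ, ContDiff ℝ ∞ φ →
    ∫ x in Ω, (inner ℝ (x - c) (gradient φ x) + 2 * φ x) = κ * ∫ x, φ x ∂(boundaryMeasure Ω)

lemma continuous_gradient {φ : Plane → ℝ} (h : ContDiff ℝ ∞ φ) : Continuous (gradient φ) := by
  unfold gradient
  exact (LinearIsometryEquiv.continuous _).comp (h.continuous_fderiv (by simp))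

lemma inner_gradient (φ : Plane → ℝ) (x v : Plane) :
    inner ℝ v (gradient φ x) = fderiv ℝ φ x v := by
  rw [real_inner_comm, gradient, InnerProductSpace.toDual_symm_apply]

lemma integral_smul_gradient_eq_neg {Ω : Set Plane} {u ψ : Plane → ℝ}
    (hu : ContDiff ℝ ∞ u) (hψ : ContDiff ℝ ∞ ψ) (hc : HasCompactSupport ψ)
    (hs : tsupport ψ ⊆ Ω) :
    ∫ x in Ω, u x • gradient ψ x = - ∫ x in Ω, ψ x • gradient u x := by
  have hg : ∀ x, x ∉ tsupport ψ → gradient ψ x = 0 := by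
    intro x hx
    have : fderiv ℝ ψ x = 0 := by
      by_contra h
      exact hx (support_fderiv_subset ℝ (f := ψ) h)
    simp [gradient, this]
  have hgc : HasCompactSupport (gradient ψ) :=
    HasCompactSupport.intro hc hg
  rw [setIntegral_eq_integral_of_forall_compl_eq_zero
      (fun x hx => by rw [hg x (fun h => hx (hs h)), smul_zero]),
    setIntegral_eq_integral_of_forall_compl_eq_zero
      (fun x hx => by rw [image_eq_zero_of_notMem_tsupport (fun h => hx (hs h)), zero_smul])]
  have hi1 : Integrable fun x => u x • gradient ψ x :=
    (hu.continuous.smul (continuous_gradient hψ)).integrable_of_hasCompactSupport hgc.smul_left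
  have hi2 : Integrable fun x => ψ x • gradient u x :=
    (hψ.continuous.smul (continuous_gradient hu)).integrable_of_hasCompactSupport hc.smul_right
  refine ext_inner_left ℝ fun v => ?_
  rw [inner_neg_right, ← integral_inner hi1 v, ← integral_inner hi2 v]
  simp only [inner_smul_right, inner_gradient]
  have h := integral_mul_fderiv_eq_neg_fderiv_mul_of_integrable (μ := volume) (f := u) (g := ψ)
    (v := v) ?_ ?_ ?_ (fun x _ => hu.differentiable (by simp) x)
    (fun x _ => hψ.differentiable (by simp) x)
  · rw [h]; simp only [mul_comm]
  · have := hi2.const_inner (𝕜 := ℝ) v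
    simpa only [inner_smul_right, inner_gradient, mul_comm] using this
  · have := hi1.const_inner (𝕜 := ℝ) v
    simpa only [inner_smul_right, inner_gradient] using this
  · exact (hu.continuous.mul hψ.continuous).integrable_of_hasCompactSupport hc.mul_left

lemma isFiniteMeasure_restrict_of_isBounded {Ω : Set Plane} (hb : Bornology.IsBounded Ω) :
    IsFiniteMeasure (volume.restrict Ω) :=
  isFiniteMeasure_restrict.2 hb.measure_lt_top.ne

lemma memLp_restrict_of_continuous {E : Type*} [NormedAddCommGroup E]
    [SecondCountableTopology E] [MeasurableSpace E] [BorelSpace E] {μ : Measure Plane}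
    {S : Set Plane} (hS : MeasurableSet S)
    [IsFiniteMeasure (μ.restrict S)] (hb : Bornology.IsBounded S) {f : Plane → E}
    (hf : Continuous f) (p : ℝ≥0∞) : MemLp f p (μ.restrict S) := by
  obtain ⟨C, hC⟩ := (hb.isCompact_closure.bddAbove_image (f := fun x => ‖f x‖)
    hf.norm.continuousOn)
  refine MemLp.of_bound hf.aestronglyMeasurable C ?_
  filter_upwards [ae_restrict_mem hS] with x hx
  exact hC ⟨x, subset_closure hx, rfl⟩

lemma isBounded_frontier {Ω : Set Plane} (hb : Bornology.IsBounded Ω) :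
    Bornology.IsBounded (frontier Ω) :=
  hb.closure.subset frontier_subset_closure

lemma tendsto_integral_of_tendsto_eLpNorm_two {α E : Type*} [MeasurableSpace α]
    [NormedAddCommGroup E] [NormedSpace ℝ E] {μ : Measure α} [IsFiniteMeasure μ] {f : ℕ → α → E}
    {g : α → E} (hf : ∀ k, MemLp (f k) 2 μ) (hg : MemLp g 2 μ)
    (h : Tendsto (fun k => eLpNorm (fun x => f k x - g x) 2 μ) atTop (𝓝 0)) :
    Tendsto (fun k => ∫ x, f k x ∂μ) atTop (𝓝 (∫ x, g x ∂μ)) := by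
  refine tendsto_integral_of_L1' g hg.aestronglyMeasurable
    (Eventually.of_forall fun k => (hf k).integrable (by norm_num)) ?_
  have hb : ∀ k, eLpNorm (f k - g) 1 μ ≤
      eLpNorm (fun x => f k x - g x) 2 μ * μ Set.univ ^ (1 / (1 : ℝ≥0∞).toReal - 1 / (2 : ℝ≥0∞).toReal) :=
    fun k => eLpNorm_le_eLpNorm_mul_rpow_measure_univ (by norm_num)
      ((hf k).sub hg).aestronglyMeasurable
  refine tendsto_of_tendsto_of_tendsto_of_le_of_le tendsto_const_nhds ?_ (fun _ => zero_le) hb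
  have := ENNReal.Tendsto.mul_const (b := μ Set.univ ^ (1 / (1 : ℝ≥0∞).toReal - 1 / (2 : ℝ≥0∞).toReal))
    h (Or.inr (ENNReal.rpow_ne_top_of_nonneg (by norm_num) (measure_ne_top _ _)))
  simpa using this

section Minimizer

variable {Ω : Set Plane} {c : Plane} {κ : ℝ}

/-- The identity extends from smooth functions to Sobolev functions with their traces. -/
lemma RadialIdentity.integral_eq (hid : RadialIdentity Ω c κ) (hO : MeasurableSet Ω)
    (hb : Bornology.IsBounded Ω) [IsFiniteMeasure (boundaryMeasure Ω)]
    {u g : Plane → ℝ} {G : Plane → Plane} (hu : IsSobolev Ω u G) (hg : IsTrace Ω u G g) :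
    (∫ x in Ω, inner ℝ (x - c) (G x)) + 2 * ∫ x in Ω, u x = κ * ∫ x, g x ∂(boundaryMeasure Ω) := by
  have := isFiniteMeasure_restrict_of_isBounded hb
  obtain ⟨φ, hφ, h1, h2, h3⟩ := hg.exists_approx
  have hbm : IsFiniteMeasure ((Measure.hausdorffMeasure 1).restrict (frontier Ω)) :=
    inferInstanceAs (IsFiniteMeasure (boundaryMeasure Ω))
  have m1 : ∀ k, MemLp (φ k) 2 (volume.restrict Ω) := fun k =>
    memLp_restrict_of_continuous hO hb (hφ k).continuous 2
  have m2 : ∀ k, MemLp (gradient (φ k)) 2 (volume.restrict Ω) := fun k =>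
    memLp_restrict_of_continuous hO hb (continuous_gradient (hφ k)) 2
  have m3 : ∀ k, MemLp (φ k) 2 (boundaryMeasure Ω) := fun k =>
    memLp_restrict_of_continuous isClosed_frontier.measurableSet (isBounded_frontier hb)
      (hφ k).continuous 2
  -- Boundedness of `x - c` on `Ω` makes `F ↦ ⟨x - c, F⟩` bounded on `L²(Ω)`, so this term also
  -- passes to the limit.
  obtain ⟨C, hC0, hC⟩ : ∃ C : ℝ, 0 ≤ C ∧ ∀ x ∈ Ω, ‖x - c‖ ≤ C := by
    obtain ⟨C, hC⟩ := hb.exists_norm_le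
    refine ⟨max C 0 + ‖c‖, by positivity, fun x hx => (norm_sub_le _ _).trans ?_⟩
    gcongr
    exact (hC x hx).trans (le_max_left _ _)
  have hxc : Continuous fun x : Plane => x - c := by fun_prop
  have hbound : ∀ F : Plane → Plane, ∀ᵐ x ∂volume.restrict Ω,
      ‖inner ℝ (x - c) (F x)‖ ≤ C * ‖F x‖ := by
    intro F
    filter_upwards [ae_restrict_mem hO] with x hx
    exact (norm_inner_le_norm _ _).trans (by gcongr; exact hC x hx)
  have mi : ∀ F : Plane → Plane, MemLp F 2 (volume.restrict Ω) →
      MemLp (fun x => inner ℝ (x - c) (F x)) 2 (volume.restrict Ω) := fun F hF =>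
    hF.of_le_mul (hxc.aestronglyMeasurable.inner hF.aestronglyMeasurable) (hbound F)
  have t1 := tendsto_integral_of_tendsto_eLpNorm_two m1 hu.memLp h1
  have t3 := tendsto_integral_of_tendsto_eLpNorm_two m3 hg.memLp h3
  have t2 := tendsto_integral_of_tendsto_eLpNorm_two (fun k => mi _ (m2 k)) (mi _ hu.memLp_grad) (by
    have : ∀ k, eLpNorm (fun x => inner ℝ (x - c) (gradient (φ k) x) - inner ℝ (x - c) (G x)) 2
        (volume.restrict Ω) ≤ ENNReal.ofReal C *
          eLpNorm (fun x => gradient (φ k) x - G x) 2 (volume.restrict Ω) := by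
      intro k
      simp only [← inner_sub_right]
      exact eLpNorm_le_mul_eLpNorm_of_ae_le_mul (hbound _) 2
    refine tendsto_of_tendsto_of_tendsto_of_le_of_le tendsto_const_nhds ?_ (fun _ => zero_le) this
    have := ENNReal.Tendsto.const_mul (a := ENNReal.ofReal C) h2 (Or.inr ENNReal.ofReal_ne_top)
    simpa using this)
  refine tendsto_nhds_unique (t2.add (t1.const_mul 2)) ((t3.const_mul κ).congr fun k => ?_)
  rw [← hid (φ k) (hφ k), integral_add ((mi _ (m2 k)).integrable (by norm_num))
    (((m1 k).integrable (by norm_num)).const_mul 2), integral_const_mul]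

lemma integrable_inner_of_memLp {μ : Measure Plane} {F G : Plane → Plane} (hF : MemLp F 2 μ)
    (hG : MemLp G 2 μ) : Integrable (fun x => inner ℝ (F x) (G x)) μ := by
  have h1 := (hF.add hG).integrable_norm_pow (p := 2) (by norm_num)
  have h2 := (hF.sub hG).integrable_norm_pow (p := 2) (by norm_num)
  refine ((h1.sub h2).const_mul (1 / 4)).congr (Eventually.of_forall fun x => ?_)
  simp only [Pi.sub_apply, Pi.add_apply]
  rw [norm_add_sq_real, norm_sub_sq_real]
  ring

/-- The zero boundary mean replaces `-∫ u` by `½ ∫ ⟨x - c, G⟩`; what remains is a completed square.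
-/
lemma RadialIdentity.le_energy (hid : RadialIdentity Ω c κ) (hO : MeasurableSet Ω)
    (hb : Bornology.IsBounded Ω) [IsFiniteMeasure (boundaryMeasure Ω)]
    {u : Plane → ℝ} {G : Plane → Plane} (hu : IsAdmissible Ω u G) :
    -(1 / 8) * ∫ x in Ω, ‖x - c‖ ^ 2 ≤ energy Ω u G := by
  have := isFiniteMeasure_restrict_of_isBounded hb
  obtain ⟨hS, g, hg, h0⟩ := hu
  have key := hid.integral_eq hO hb hS hg
  rw [h0, mul_zero] at key
  have hxc : MemLp (fun x : Plane => x - c) 2 (volume.restrict Ω) :=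
    memLp_restrict_of_continuous hO hb (by fun_prop) 2
  have i1 := hxc.integrable_norm_pow (p := 2) (by norm_num)
  have i2 := hS.memLp_grad.integrable_norm_pow (p := 2) (by norm_num)
  have i3 := integrable_inner_of_memLp hxc hS.memLp_grad
  -- The integrand is `⅛ ‖x - c + 2 G‖²`.
  have hnn : 0 ≤ ∫ x in Ω, ((1 / 2) * ‖G x‖ ^ 2 + ((1 / 8) * ‖x - c‖ ^ 2 +
      (1 / 2) * inner ℝ (x - c) (G x))) := by
    refine integral_nonneg fun x => ?_
    have h := norm_add_sq_real (x - c) ((2 : ℝ) • G x)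
    rw [norm_smul, inner_smul_right, Real.norm_eq_abs, abs_of_pos two_pos] at h
    have := sq_nonneg ‖x - c + (2 : ℝ) • G x‖
    simp only [Pi.zero_apply]
    nlinarith
  have i4 := (i1.const_mul (1 / 8)).add (i3.const_mul (1 / 2))
  rw [integral_add (i2.const_mul _) (by exact i4),
    integral_add (i1.const_mul _) (i3.const_mul _), integral_const_mul, integral_const_mul,
    integral_const_mul] at hnn
  rw [energy]
  linarith

/-- The explicit minimizer. -/
noncomputable def radialProfile (Ω : Set Plane) (c : Plane) (x : Plane) : ℝ :=
  (1 / (4 * perimeter Ω)) * (∫ y, ‖y - c‖ ^ 2 ∂(boundaryMeasure Ω)) - ‖x - c‖ ^ 2 / 4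

lemma contDiff_radialProfile (Ω : Set Plane) (c : Plane) : ContDiff ℝ ∞ (radialProfile Ω c) := by
  unfold radialProfile
  exact contDiff_const.sub (((contDiff_id.sub contDiff_const).norm_sq ℝ).div_const 4)

lemma gradient_radialProfile (Ω : Set Plane) (c x : Plane) :
    gradient (radialProfile Ω c) x = -(1 / 2 : ℝ) • (x - c) := by
  refine ext_inner_left ℝ fun v => ?_
  rw [inner_gradient]
  have h : HasFDerivAt (radialProfile Ω c) (-((4 : ℝ)⁻¹ • (2 • (innerSL ℝ (x - c))))) x := by
    have h1 := ((hasFDerivAt_id x).sub_const c).norm_sq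
    have h2 := (h1.mul_const (4 : ℝ)⁻¹).const_sub
      ((1 / (4 * perimeter Ω)) * (∫ y, ‖y - c‖ ^ 2 ∂(boundaryMeasure Ω)))
    exact h2.congr_fderiv (by ext; simp)
  rw [h.fderiv]
  simp [inner_smul_right, inner_sub_right, real_inner_comm]
  ring

lemma isAdmissible_radialProfile (hO : MeasurableSet Ω)
    (hb : Bornology.IsBounded Ω) [IsFiniteMeasure (boundaryMeasure Ω)]
    (hσ : boundaryMeasure Ω Set.univ ≠ 0) (c : Plane) :
    IsAdmissible Ω (radialProfile Ω c) (gradient (radialProfile Ω c)) := by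
  have := isFiniteMeasure_restrict_of_isBounded hb
  have hbm : IsFiniteMeasure ((Measure.hausdorffMeasure 1).restrict (frontier Ω)) :=
    inferInstanceAs (IsFiniteMeasure (boundaryMeasure Ω))
  have hs := contDiff_radialProfile Ω c
  have hm : ∀ (f : Plane → ℝ), Continuous f → MemLp f 2 (boundaryMeasure Ω) := fun f hf =>
    memLp_restrict_of_continuous isClosed_frontier.measurableSet (isBounded_frontier hb) hf 2
  refine ⟨⟨memLp_restrict_of_continuous hO hb hs.continuous 2,
    memLp_restrict_of_continuous hO hb (continuous_gradient hs) 2,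
    fun ψ h1 h2 h3 => integral_smul_gradient_eq_neg hs h1 h2 h3⟩,
    -- The profile is smooth, so the constant sequence approximates it and its trace is its
    -- restriction.
    radialProfile Ω c, ⟨hm _ hs.continuous, fun _ => radialProfile Ω c, fun _ => hs, ?_, ?_, ?_⟩, ?_⟩
  · simp
  · simp
  · simp
  · have hP : perimeter Ω ≠ 0 := by
      rw [perimeter, measureReal_def]
      exact ENNReal.toReal_ne_zero.2 ⟨hσ, measure_ne_top _ _⟩
    have hi : Integrable (fun y => ‖y - c‖ ^ 2) (boundaryMeasure Ω) :=
      (hm _ (by fun_prop)).integrable (by norm_num)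
    unfold radialProfile
    rw [integral_sub (integrable_const _) (hi.div_const 4), integral_const, integral_div]
    change perimeter Ω • _ - _ = 0
    rw [smul_eq_mul]
    field_simp
    ring

/-- The profile has gradient `-(x - c)/2`, exactly where the square behind
`RadialIdentity.le_energy` vanishes. The value of `κ` plays no role, as it only multiplies a zero
boundary integral. -/
theorem RadialIdentity.T_eq (hid : RadialIdentity Ω c κ) (hO : MeasurableSet Ω)
    (hb : Bornology.IsBounded Ω) [IsFiniteMeasure (boundaryMeasure Ω)]
    (hσ : boundaryMeasure Ω Set.univ ≠ 0) :
    IsMinimizer Ω (radialProfile Ω c) ∧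
      T Ω = ((-(1 / 8) * ∫ x in Ω, ‖x - c‖ ^ 2 : ℝ) : EReal) := by
  have := isFiniteMeasure_restrict_of_isBounded hb
  have had := isAdmissible_radialProfile hO hb hσ c
  have hen : energy Ω (radialProfile Ω c) (gradient (radialProfile Ω c)) =
      -(1 / 8) * ∫ x in Ω, ‖x - c‖ ^ 2 := by
    obtain ⟨hS, g, hg, h0⟩ := id had
    have key := hid.integral_eq hO hb hS hg
    rw [h0, mul_zero] at key
    have e1 : ∀ x, inner ℝ (x - c) (gradient (radialProfile Ω c) x) = -(1 / 2) * ‖x - c‖ ^ 2 := by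
      intro x
      rw [gradient_radialProfile, inner_smul_right, real_inner_self_eq_norm_sq]
    have e2 : ∀ x, ‖gradient (radialProfile Ω c) x‖ ^ 2 = (1 / 4) * ‖x - c‖ ^ 2 := by
      intro x
      rw [gradient_radialProfile, norm_smul, mul_pow]
      norm_num
    simp only [e1, integral_const_mul] at key
    simp only [energy, e2, integral_const_mul]
    linarith
  have hT : T Ω = ((-(1 / 8) * ∫ x in Ω, ‖x - c‖ ^ 2 : ℝ) : EReal) := by
    refine le_antisymm ?_ ?_
    · rw [← hen]
      exact iInf_le_of_le _ (iInf_le_of_le _ (iInf_le _ had))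
    · refine le_iInf fun u => le_iInf fun G => le_iInf fun h => ?_
      exact EReal.coe_le_coe_iff.2 (hid.le_energy hO hb h)
  exact ⟨⟨_, had, by rw [hen, hT]⟩, hT⟩

end Minimizer

/-! ### Polar coordinates and integrals along rays. -/

/-- The unit vector at angle `α`. -/
noncomputable def unitVec (α : ℝ) : Plane := !₂[Real.cos α, Real.sin α]

lemma inner_unitVec (α β : ℝ) : inner ℝ (unitVec α) (unitVec β) = Real.cos (α - β) := by
  simp [unitVec, PiLp.inner_apply, Fin.sum_univ_two, Real.cos_sub]
  ring

@[simp] lemma norm_unitVec (α : ℝ) : ‖unitVec α‖ = 1 := by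
  have h := real_inner_self_eq_norm_sq (unitVec α)
  rw [inner_unitVec, sub_self, Real.cos_zero] at h
  nlinarith [norm_nonneg (unitVec α)]

lemma continuous_unitVec : Continuous unitVec := by
  unfold unitVec
  refine (PiLp.continuous_toLp 2 _).comp (continuous_pi fun i => ?_)
  fin_cases i
  · exact Real.continuous_cos
  · exact Real.continuous_sin

lemma unitVec_periodic : Function.Periodic unitVec (2 * Real.pi) := by
  intro α
  simp [unitVec]

lemma exists_eq_smul_unitVec (x : Plane) : ∃ α, x = ‖x‖ • unitVec α := by
  let z : ℂ := ⟨x 0, x 1⟩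
  have hz : ‖z‖ = ‖x‖ := by
    rw [Complex.norm_eq_sqrt_sq_add_sq, EuclideanSpace.norm_eq, Fin.sum_univ_two]
    simp [z]
  refine ⟨z.arg, ?_⟩
  ext i
  rw [← hz]
  fin_cases i
  · exact (Complex.norm_mul_cos_arg z).symm
  · exact (Complex.norm_mul_sin_arg z).symm

/-- Coordinates on the plane with origin `c`. -/
noncomputable def coordEquiv (c : Plane) : ℝ × ℝ ≃ᵐ Plane :=
  (MeasurableEquiv.finTwoArrow.symm.trans (MeasurableEquiv.toLp 2 (Fin 2 → ℝ))).trans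
    (MeasurableEquiv.addLeft c)

lemma coordEquiv_polarCoord_symm (c : Plane) (p : ℝ × ℝ) :
    coordEquiv c (polarCoord.symm p) = c + p.1 • unitVec p.2 := by
  change c + WithLp.toLp 2 (MeasurableEquiv.finTwoArrow.symm (polarCoord.symm p)) = _
  congr 1
  ext i
  fin_cases i
  · simp [unitVec, MeasurableEquiv.finTwoArrow]
  · simp [unitVec, MeasurableEquiv.finTwoArrow]

lemma measurePreserving_coordEquiv (c : Plane) : MeasurePreserving (coordEquiv c) :=
  (measurePreserving_add_left volume c).comp
    ((PiLp.volume_preserving_toLp (Fin 2)).comp (volume_preserving_finTwoArrow ℝ).symm)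

lemma integral_eq_integral_polar {f : Plane → ℝ} (hf : Integrable f) (c : Plane) :
    ∫ x, f x = ∫ α in (-Real.pi)..Real.pi, ∫ s in Set.Ioi 0, s * f (c + s • unitVec α) := by
  have hm := measurePreserving_coordEquiv c
  -- Fubini needs integrability with the Jacobian included; the change of variables formula supplies
  -- it.
  have hint : Integrable (fun p : ℝ × ℝ => p.1 * f (c + p.1 • unitVec p.2))
      ((volume.restrict (Set.Ioi 0)).prod (volume.restrict (Set.Ioo (-Real.pi) Real.pi))) := by
    rw [Measure.prod_restrict, ← Measure.volume_eq_prod]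
    have h1 : Integrable (f ∘ coordEquiv c) := (hm.integrable_comp_emb
      (coordEquiv c).measurableEmbedding).2 hf
    have hi : IntegrableOn (f ∘ coordEquiv c) (polarCoord.symm '' polarCoord.target) :=
      h1.integrableOn
    rw [integrableOn_image_iff_integrableOn_abs_det_fderiv_smul volume
      polarCoord.open_target.measurableSet
      (fun p _ => (hasFDerivAt_polarCoord_symm p).hasFDerivWithinAt)
      polarCoord.symm.injOn] at hi
    refine IntegrableOn.congr_fun hi (fun p hp => ?_) polarCoord.open_target.measurableSet
    have hp0 : 0 < p.1 := hp.1
    simp only [det_fderivPolarCoordSymm, Function.comp_apply, coordEquiv_polarCoord_symm,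
      abs_of_pos hp0, smul_eq_mul]
  rw [← hm.integral_comp (coordEquiv c).measurableEmbedding, ← integral_comp_polarCoord_symm,
    intervalIntegral.integral_of_le (by linarith [Real.pi_pos]), integral_Ioc_eq_integral_Ioo]
  simp only [coordEquiv_polarCoord_symm, smul_eq_mul]
  change ∫ p in Set.Ioi 0 ×ˢ Set.Ioo (-Real.pi) Real.pi, _ = _
  rw [Measure.volume_eq_prod, ← Measure.prod_restrict, integral_prod_symm _ hint]

/-- The integral of `⟨x - c, ∇φ⟩ + 2 φ` over the part of `Ω` on a ray from `c`. -/
noncomputable def rayIntegral (Ω : Set Plane) (c : Plane) (φ : Plane → ℝ) (α : ℝ) : ℝ :=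
  ∫ s in Set.Ioi 0, s * Ω.indicator (fun x => inner ℝ (x - c) (gradient φ x) + 2 * φ x)
    (c + s • unitVec α)

/-- By periodicity the angle may start anywhere; for polygons it will start at a vertex, so that the
sectors over the sides fit the interval. -/
lemma integral_eq_integral_rayIntegral {Ω : Set Plane} (hO : MeasurableSet Ω)
    (hb : Bornology.IsBounded Ω) (c : Plane) {φ : Plane → ℝ} (hφ : ContDiff ℝ ∞ φ) (a : ℝ) :
    ∫ x in Ω, (inner ℝ (x - c) (gradient φ x) + 2 * φ x) =
      ∫ α in a..(a + 2 * Real.pi), rayIntegral Ω c φ α := by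
  have := isFiniteMeasure_restrict_of_isBounded hb
  have hc : Continuous (fun x => inner ℝ (x - c) (gradient φ x) + 2 * φ x) := by
    have := continuous_gradient hφ
    have := hφ.continuous
    fun_prop
  have hi : Integrable (fun x => inner ℝ (x - c) (gradient φ x) + 2 * φ x) (volume.restrict Ω) :=
    (memLp_restrict_of_continuous hO hb hc 1).integrable le_rfl
  rw [← integral_indicator hO,
    integral_eq_integral_polar ((integrable_indicator_iff hO).2 hi) c]
  have hp : Function.Periodic (rayIntegral Ω c φ) (2 * Real.pi) := by
    intro α
    simp only [rayIntegral, unitVec_periodic α]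
  rw [hp.intervalIntegral_add_eq a (-Real.pi)]
  congr 1
  ring

/-- The integrand is the derivative of `s² φ(c + s ω)` along the ray, so only the exit point at
distance `ρ` contributes. -/
lemma rayIntegral_eq {Ω : Set Plane} {c : Plane} {φ : Plane → ℝ} (hφ : ContDiff ℝ ∞ φ)
    {α ρ : ℝ} (hρ : 0 < ρ) (hmem : ∀ s, 0 < s → (c + s • unitVec α ∈ Ω ↔ s < ρ)) :
    rayIntegral Ω c φ α = ρ ^ 2 * φ (c + ρ • unitVec α) := by
  have hd : ∀ s, HasDerivAt (fun s : ℝ => s ^ 2 * φ (c + s • unitVec α))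
      (s * (inner ℝ (c + s • unitVec α - c) (gradient φ (c + s • unitVec α))
        + 2 * φ (c + s • unitVec α))) s := by
    intro s
    have h1 : HasDerivAt (fun s : ℝ => c + s • unitVec α) (unitVec α) s := by
      simpa using ((hasDerivAt_id s).smul_const (unitVec α)).const_add c
    have h2 := ((hφ.differentiable (by simp)
      (c + s • unitVec α)).hasFDerivAt).comp_hasDerivAt s h1
    refine HasDerivAt.congr_deriv (((hasDerivAt_id s).pow 2).mul h2) ?_
    rw [inner_gradient, add_sub_cancel_left, map_smul]
    simp
    ring
  have e1 : rayIntegral Ω c φ α = ∫ s in Set.Ioo 0 ρ,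
      (s * (inner ℝ (c + s • unitVec α - c) (gradient φ (c + s • unitVec α))
        + 2 * φ (c + s • unitVec α))) := by
    rw [rayIntegral, ← integral_indicator measurableSet_Ioi, ← integral_indicator measurableSet_Ioo]
    congr 1
    ext s
    by_cases h0 : 0 < s
    · rw [Set.indicator_of_mem (show s ∈ Set.Ioi (0 : ℝ) from h0)]
      by_cases hs : s < ρ
      · rw [Set.indicator_of_mem ((hmem s h0).2 hs), Set.indicator_of_mem (Set.mem_Ioo.2 ⟨h0, hs⟩)]
      · rw [Set.indicator_of_notMem (fun h => hs ((hmem s h0).1 h)),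
          Set.indicator_of_notMem (fun h => hs h.2), mul_zero]
    · rw [Set.indicator_of_notMem (show s ∉ Set.Ioi (0 : ℝ) from h0), Set.indicator_of_notMem (fun h => h0 h.1)]
  have hc : Continuous (fun s : ℝ => s * (inner ℝ (c + s • unitVec α - c)
      (gradient φ (c + s • unitVec α)) + 2 * φ (c + s • unitVec α))) := by
    have := continuous_gradient hφ
    have := hφ.continuous
    fun_prop
  rw [e1, ← integral_Ioc_eq_integral_Ioo, ← intervalIntegral.integral_of_le hρ.le,
    intervalIntegral.integral_eq_sub_of_hasDerivAt (fun s _ => hd s) (hc.intervalIntegrable _ _)]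
  simp

/-- Euler's relation in degree two. It lets the radial identity express the second moment by a
boundary integral. -/
lemma inner_gradient_norm_sub_sq (c x : Plane) :
    inner ℝ (x - c) (gradient (fun x : Plane => ‖x - c‖ ^ 2) x) + 2 * ‖x - c‖ ^ 2 =
      4 * ‖x - c‖ ^ 2 := by
  have h1 := ((hasFDerivAt_id x).sub_const c).norm_sq
  rw [inner_gradient]
  simp only [id] at h1
  rw [h1.fderiv]
  simp only [smul_apply, ContinuousLinearMap.comp_id, innerSL_apply_apply,
    real_inner_self_eq_norm_sq, nsmul_eq_mul]
  push_cast
  ring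

/-! ### Regular polygons as intersections of half planes. -/

/-- The angle of the outer normal of the `k`-th side of a regular `N`-gon whose first vertex is
at angle `θ`. -/
noncomputable def normalAngle (N : ℕ) (θ : ℝ) (k : ℤ) : ℝ := θ + (2 * k + 1) * (Real.pi / N)

/-- The regular `N`-gon with center `c` and apothem `r`, as an intersection of half planes. -/
def openPolygon (N : ℕ) (θ r : ℝ) (c : Plane) : Set Plane :=
  {x | ∀ k : ℤ, inner ℝ (x - c) (unitVec (normalAngle N θ k)) < r}

/-- The closed regular `N`-gon with center `c` and apothem `r`. -/
def closedPolygon (N : ℕ) (θ r : ℝ) (c : Plane) : Set Plane :=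
  {x | ∀ k : ℤ, inner ℝ (x - c) (unitVec (normalAngle N θ k)) ≤ r}

section

variable {N : ℕ} {θ r : ℝ} {c : Plane}

lemma unitVec_add_int_mul_two_pi (α : ℝ) (n : ℤ) : unitVec (α + n * (2 * Real.pi)) = unitVec α :=
  unitVec_periodic.int_mul n α

/-- The normals are `N`-periodic in the index. Integer indices allow rounding to the nearest normal;
finitely many of them suffice for openness and for the list of sides. -/
lemma exists_fin_unitVec_normalAngle (hN : 0 < N) (θ : ℝ) (k : ℤ) : ∃ j : Fin N,
    unitVec (normalAngle N θ k) = unitVec (normalAngle N θ (j : ℤ)) := by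
  have hN' : (N : ℤ) ≠ 0 := by exact_mod_cast hN.ne'
  have hNr : (N : ℝ) ≠ 0 := by exact_mod_cast hN.ne'
  have h0 := Int.emod_nonneg k hN'
  have h1 := Int.emod_lt_of_pos k (show (0 : ℤ) < N by exact_mod_cast hN)
  refine ⟨⟨(k % N).toNat, by omega⟩, ?_⟩
  have e : (((k % N).toNat : ℕ) : ℤ) = k % N := Int.toNat_of_nonneg h0
  have hk : (k : ℝ) = (k % N : ℤ) + N * (k / N : ℤ) := by
    exact_mod_cast (Int.emod_add_mul_ediv k N).symm
  simp only [e]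
  rw [← unitVec_add_int_mul_two_pi (normalAngle N θ (k % N)) (k / N)]
  congr 1
  rw [normalAngle, normalAngle, hk]
  field_simp
  ring

/-- The normal nearest in angle has the largest inner product. Once `i` is reduced to `0 ≤ j < N`,
the difference of cosines is `2 sin(ψ + jπ/N) sin(jπ/N)`, with both angles in `[0, π]`. -/
lemma cos_add_two_pi_mul_div_le (hN : 0 < N) {ψ : ℝ} (hψ : |ψ| ≤ Real.pi / N) (i : ℤ) :
    Real.cos (ψ + 2 * i * (Real.pi / N)) ≤ Real.cos ψ := by
  have hN' : (N : ℤ) ≠ 0 := by exact_mod_cast hN.ne'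
  have hNr : (0 : ℝ) < N := by exact_mod_cast hN
  have h0 := Int.emod_nonneg i hN'
  have h1 := Int.emod_lt_of_pos i (show (0 : ℤ) < N by exact_mod_cast hN)
  have hi : (i : ℝ) = (i % N : ℤ) + N * (i / N : ℤ) := by
    exact_mod_cast (Int.emod_add_mul_ediv i N).symm
  have e : ψ + 2 * i * (Real.pi / N) = ψ + 2 * (i % N : ℤ) * (Real.pi / N) +
      (i / N : ℤ) * (2 * Real.pi) := by
    rw [hi]; field_simp; ring
  rw [e, Real.cos_add_int_mul_two_pi]
  generalize i % (N : ℤ) = j at *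
  obtain rfl | hj := eq_or_lt_of_le h0
  · simp
  · have hj1 : (1 : ℝ) ≤ j := by exact_mod_cast hj
    have hj2 : (j : ℝ) ≤ N - 1 := by
      have : j ≤ (N : ℤ) - 1 := by omega
      exact_mod_cast this
    have hπ := Real.pi_pos
    have hx : 0 < Real.pi / N := by positivity
    have hNx : N * (Real.pi / N) = Real.pi := by field_simp
    obtain ⟨ha, hb⟩ := abs_le.1 hψ
    have b1 : Real.pi / N ≤ j * (Real.pi / N) := by nlinarith
    have b2 : j * (Real.pi / N) ≤ Real.pi - Real.pi / N := by nlinarith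
    have s1 : 0 ≤ Real.sin (j * (Real.pi / N)) :=
      Real.sin_nonneg_of_nonneg_of_le_pi (by linarith) (by linarith)
    have s2 : 0 ≤ Real.sin (ψ + j * (Real.pi / N)) :=
      Real.sin_nonneg_of_nonneg_of_le_pi (by linarith) (by linarith)
    have h := Real.cos_sub_cos ψ (ψ + 2 * j * (Real.pi / N))
    have e1 : (ψ + (ψ + 2 * j * (Real.pi / N))) / 2 = ψ + j * (Real.pi / N) := by ring
    have e2 : (ψ - (ψ + 2 * j * (Real.pi / N))) / 2 = -(j * (Real.pi / N)) := by ring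
    rw [e1, e2, Real.sin_neg] at h
    nlinarith [mul_nonneg s1 s2]

lemma exists_abs_sub_normalAngle_le (hN : 0 < N) (θ α : ℝ) :
    ∃ k : ℤ, |α - normalAngle N θ k| ≤ Real.pi / N := by
  have hNr : (0 : ℝ) < N := by exact_mod_cast hN
  have hx : 0 < Real.pi / N := by have := Real.pi_pos; positivity
  refine ⟨round ((α - θ - Real.pi / N) / (2 * (Real.pi / N))), ?_⟩
  have h := abs_sub_round ((α - θ - Real.pi / N) / (2 * (Real.pi / N)))
  set k := round ((α - θ - Real.pi / N) / (2 * (Real.pi / N)))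
  have e : α - normalAngle N θ k =
      2 * (Real.pi / N) * ((α - θ - Real.pi / N) / (2 * (Real.pi / N)) - k) := by
    rw [normalAngle]; field_simp; ring
  rw [e, abs_mul, abs_of_pos (by linarith)]
  nlinarith

lemma cos_sub_normalAngle_le (hN : 0 < N) {α : ℝ} {k : ℤ}
    (hα : |α - normalAngle N θ k| ≤ Real.pi / N) (j : ℤ) :
    Real.cos (α - normalAngle N θ j) ≤ Real.cos (α - normalAngle N θ k) := by
  have h := cos_add_two_pi_mul_div_le hN hα (k - j)
  convert h using 2
  simp only [normalAngle]
  push_cast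
  ring

lemma pi_div_lt_pi_div_two (hN : 3 ≤ N) : Real.pi / N < Real.pi / 2 := (pi_div_mem hN).2

lemma pi_div_pos (hN : 3 ≤ N) : 0 < Real.pi / N := (pi_div_mem hN).1

lemma cos_pos_of_abs_le (hN : 3 ≤ N) {ψ : ℝ} (hψ : |ψ| ≤ Real.pi / N) : 0 < Real.cos ψ := by
  have := pi_div_lt_pi_div_two hN
  obtain ⟨h1, h2⟩ := abs_le.1 hψ
  exact Real.cos_pos_of_mem_Ioo ⟨by linarith, by linarith⟩

lemma cos_pi_div_le_cos (hN : 3 ≤ N) {ψ : ℝ} (hψ : |ψ| ≤ Real.pi / N) :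
    Real.cos (Real.pi / N) ≤ Real.cos ψ := by
  rw [← Real.cos_abs ψ]
  exact Real.cos_le_cos_of_nonneg_of_le_pi (abs_nonneg _)
    (by linarith [pi_div_lt_pi_div_two hN, Real.pi_pos]) hψ

lemma inner_add_smul_sub (s α β : ℝ) :
    inner ℝ (c + s • unitVec α - c) (unitVec β) = s * Real.cos (α - β) := by
  rw [add_sub_cancel_left, real_inner_smul_left, inner_unitVec]

/-- Within `π/N` of the `k`-th normal, only the `k`-th half plane matters. -/
lemma add_smul_mem_openPolygon (hN : 0 < N) {α s : ℝ} {k : ℤ} (hs : 0 ≤ s)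
    (hα : |α - normalAngle N θ k| ≤ Real.pi / N) :
    c + s • unitVec α ∈ openPolygon N θ r c ↔ s * Real.cos (α - normalAngle N θ k) < r := by
  constructor
  · intro h
    have := h k
    rwa [inner_add_smul_sub] at this
  · intro h j
    rw [inner_add_smul_sub]
    exact (mul_le_mul_of_nonneg_left (cos_sub_normalAngle_le hN hα j) hs).trans_lt h

lemma add_smul_mem_closedPolygon (hN : 0 < N) {α s : ℝ} {k : ℤ} (hs : 0 ≤ s)
    (hα : |α - normalAngle N θ k| ≤ Real.pi / N) :
    c + s • unitVec α ∈ closedPolygon N θ r c ↔ s * Real.cos (α - normalAngle N θ k) ≤ r := by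
  constructor
  · intro h
    have := h k
    rwa [inner_add_smul_sub] at this
  · intro h j
    rw [inner_add_smul_sub]
    exact (mul_le_mul_of_nonneg_left (cos_sub_normalAngle_le hN hα j) hs).trans h

lemma exists_polar (hN : 0 < N) (θ : ℝ) (c x : Plane) : ∃ (s α : ℝ) (k : ℤ), 0 ≤ s ∧
    |α - normalAngle N θ k| ≤ Real.pi / N ∧ x = c + s • unitVec α := by
  obtain ⟨α, hα⟩ := exists_eq_smul_unitVec (x - c)
  obtain ⟨k, hk⟩ := exists_abs_sub_normalAngle_le hN θ α
  exact ⟨‖x - c‖, α, k, norm_nonneg _, hk, by rw [← hα]; abel⟩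

lemma isOpen_openPolygon (hN : 0 < N) : IsOpen (openPolygon N θ r c) := by
  have e : openPolygon N θ r c =
      ⋂ k : Fin N, {x | inner ℝ (x - c) (unitVec (normalAngle N θ (k : ℤ))) < r} := by
    ext x
    simp only [openPolygon, Set.mem_ofPred_eq, Set.mem_iInter]
    refine ⟨fun h k => h _, fun h k => ?_⟩
    obtain ⟨j, hj⟩ := exists_fin_unitVec_normalAngle hN θ k
    rw [hj]
    exact h j
  rw [e]
  exact isOpen_iInter_of_finite fun k => isOpen_lt (by fun_prop) continuous_const

lemma isClosed_closedPolygon : IsClosed (closedPolygon N θ r c) := by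
  simp only [closedPolygon, Set.ofPred_forall]
  exact isClosed_iInter fun k => isClosed_le (by fun_prop) continuous_const

lemma convex_closedPolygon : Convex ℝ (closedPolygon N θ r c) := by
  intro x hx y hy a b ha hb hab k
  have e : a • x + b • y - c = a • (x - c) + b • (y - c) := by
    have : c = a • c + b • c := by rw [← add_smul, hab, one_smul]
    nth_rewrite 1 [this]
    module
  rw [e, inner_add_left, real_inner_smul_left, real_inner_smul_left]
  have h1 := mul_le_mul_of_nonneg_left (hx k) ha
  have h2 := mul_le_mul_of_nonneg_left (hy k) hb
  have : a * r + b * r = r := by rw [← add_mul, hab, one_mul]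
  linarith

lemma openPolygon_subset_closedPolygon : openPolygon N θ r c ⊆ closedPolygon N θ r c :=
  fun _ hx k => (hx k).le

lemma isBounded_closedPolygon (hN : 3 ≤ N) : Bornology.IsBounded (closedPolygon N θ r c) := by
  have h0 := cos_pos_of_abs_le hN (abs_of_pos (pi_div_pos hN)).le
  refine (Metric.isBounded_closedBall (x := c) (r := r / Real.cos (Real.pi / N))).subset ?_
  intro x hx
  obtain ⟨s, α, k, hs, hα, rfl⟩ := exists_polar (by omega : 0 < N) θ c x
  rw [add_smul_mem_closedPolygon (by omega) hs hα] at hx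
  rw [mem_closedBall_iff_norm, add_sub_cancel_left, norm_smul, norm_unitVec, mul_one,
    Real.norm_of_nonneg hs, le_div_iff₀ h0]
  exact (mul_le_mul_of_nonneg_left (cos_pi_div_le_cos hN hα) hs).trans hx

lemma isBounded_openPolygon (hN : 3 ≤ N) : Bornology.IsBounded (openPolygon N θ r c) :=
  (isBounded_closedPolygon hN).subset openPolygon_subset_closedPolygon

/-- An interior point can be pushed slightly away from `c` without leaving the set, which excludes
equality because `r > 0`. -/
lemma interior_closedPolygon (hN : 0 < N) (hr : 0 < r) :
    interior (closedPolygon N θ r c) = openPolygon N θ r c := by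
  refine subset_antisymm (fun x hx k => ?_)
    (interior_maximal openPolygon_subset_closedPolygon (isOpen_openPolygon hN))
  have ht : Tendsto (fun t : ℝ => x + t • (x - c)) (𝓝[>] 0) (𝓝 x) := by
    have : Continuous fun t : ℝ => x + t • (x - c) := by fun_prop
    have h := this.tendsto 0
    simp only [zero_smul, add_zero] at h
    exact h.mono_left nhdsWithin_le_nhds
  obtain ⟨t, ht1, ht0⟩ := ((ht.eventually (mem_interior_iff_mem_nhds.1 hx)).and
    self_mem_nhdsWithin).exists
  have h := ht1 k
  have e : x + t • (x - c) - c = (1 + t) • (x - c) := by module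
  rw [e, real_inner_smul_left] at h
  have ht0 : 0 < t := ht0
  by_contra hle
  nlinarith

lemma closure_openPolygon (hr : 0 < r) :
    closure (openPolygon N θ r c) = closedPolygon N θ r c := by
  refine subset_antisymm (closure_minimal openPolygon_subset_closedPolygon isClosed_closedPolygon)
    fun x hx => ?_
  have ht : Tendsto (fun t : ℝ => x - t • (x - c)) (𝓝[>] 0) (𝓝 x) := by
    have : Continuous fun t : ℝ => x - t • (x - c) := by fun_prop
    have h := this.tendsto 0
    simp only [zero_smul, sub_zero] at h
    exact h.mono_left nhdsWithin_le_nhds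
  refine mem_closure_of_tendsto ht ?_
  filter_upwards [Ioo_mem_nhdsGT (show (0 : ℝ) < 1 from one_pos)] with t ht k
  have h := hx k
  have e : x - t • (x - c) - c = (1 - t) • (x - c) := by module
  rw [e, real_inner_smul_left]
  nlinarith [ht.1, ht.2]

lemma frontier_openPolygon (hN : 0 < N) (hr : 0 < r) :
    frontier (openPolygon N θ r c) = closedPolygon N θ r c \ openPolygon N θ r c := by
  rw [frontier, closure_openPolygon hr, (isOpen_openPolygon hN).interior_eq]

/-- The `k`-th vertex of a regular `N`-gon with center `c` and circumradius `R`. -/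
noncomputable def vertex (N : ℕ) (θ R : ℝ) (c : Plane) (k : ℤ) : Plane :=
  c + R • unitVec (θ + 2 * k * (Real.pi / N))

lemma exists_fin_vertex (hN : 0 < N) (θ R : ℝ) (c : Plane) (k : ℤ) : ∃ j : Fin N,
    vertex N θ R c k = vertex N θ R c (j : ℤ) := by
  obtain ⟨j, hj⟩ := exists_fin_unitVec_normalAngle hN (θ - Real.pi / N) k
  refine ⟨j, ?_⟩
  have e : ∀ i : ℤ, normalAngle N (θ - Real.pi / N) i = θ + 2 * i * (Real.pi / N) := by
    intro i; rw [normalAngle]; ring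
  rw [e, e] at hj
  rw [vertex, vertex, hj]

/-- Multiplied by `2 sin(π/N)`, the sum telescopes over a full period. It shows that the center is
the mean of the vertices. -/
lemma sum_unitVec_eq_zero (hN : 3 ≤ N) (θ : ℝ) :
    ∑ k ∈ Finset.range N, unitVec (θ + 2 * k * (Real.pi / N)) = 0 := by
  have hNr : (N : ℝ) ≠ 0 := by
    have : (3 : ℝ) ≤ N := by exact_mod_cast hN
    linarith
  have hs : 0 < Real.sin (Real.pi / N) := Real.sin_pos_of_pos_of_lt_pi (pi_div_pos hN)
    (by linarith [pi_div_lt_pi_div_two hN, Real.pi_pos])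
  let F : ℕ → Plane := fun k => unitVec (θ + (2 * k - 1) * (Real.pi / N) - Real.pi / 2)
  have h1 : ∀ k : ℕ, (2 * Real.sin (Real.pi / N)) • unitVec (θ + 2 * k * (Real.pi / N)) =
      F (k + 1) - F k := by
    intro k
    have ea : θ + (2 * ((k + 1 : ℕ) : ℝ) - 1) * (Real.pi / N) =
      (θ + 2 * k * (Real.pi / N)) + Real.pi / N := by push_cast; ring
    have eb : θ + (2 * (k : ℝ) - 1) * (Real.pi / N) =
      (θ + 2 * k * (Real.pi / N)) - Real.pi / N := by ring
    ext i
    simp only [F, ea, eb]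
    fin_cases i
    · simp [unitVec, Real.cos_sub_pi_div_two, Real.sin_add, Real.sin_sub]
      ring
    · simp [unitVec, Real.sin_sub_pi_div_two, Real.cos_add, Real.cos_sub]
      ring
  have h2 : (2 * Real.sin (Real.pi / N)) •
      ∑ k ∈ Finset.range N, unitVec (θ + 2 * k * (Real.pi / N)) = 0 := by
    rw [Finset.smul_sum, Finset.sum_congr rfl fun k _ => h1 k, Finset.sum_range_sub, sub_eq_zero]
    simp only [F]
    rw [← unitVec_periodic (θ + (2 * ((0 : ℕ) : ℝ) - 1) * (Real.pi / N) - Real.pi / 2)]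
    congr 1
    push_cast
    field_simp
    ring
  exact (smul_eq_zero.1 h2).resolve_left (by positivity)

lemma center_mem_convexHull_vertex (hN : 3 ≤ N) (θ R : ℝ) (c : Plane) :
    c ∈ convexHull ℝ (Set.range fun k : Fin N => vertex N θ R c (k : ℤ)) := by
  have hNr : (0 : ℝ) < N := by
    have : (3 : ℝ) ≤ N := by exact_mod_cast hN
    linarith
  have h := (convex_convexHull ℝ (Set.range fun k : Fin N => vertex N θ R c (k : ℤ))).sum_mem
    (t := Finset.univ) (w := fun _ : Fin N => (1 / N : ℝ)) (z := fun k => vertex N θ R c (k : ℤ))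
    (fun _ _ => by positivity) (by simp; field_simp)
    (fun k _ => subset_convexHull ℝ _ ⟨k, rfl⟩)
  convert h using 1
  rw [← Finset.smul_sum]
  simp only [vertex, Finset.sum_add_distrib, ← Finset.smul_sum]
  have h0 := sum_unitVec_eq_zero hN θ
  rw [← Fin.sum_univ_eq_sum_range (fun k => unitVec (θ + 2 * k * (Real.pi / N)))] at h0
  simp only [Int.cast_natCast]
  rw [h0]
  simp only [Finset.sum_const, Finset.card_univ, Fintype.card_fin, smul_zero, add_zero]
  rw [← Nat.cast_smul_eq_nsmul ℝ, smul_smul, one_div, inv_mul_cancel₀ hNr.ne', one_smul]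

/-- A vertex is at angle `π/N` from an adjacent normal, so it satisfies that constraint with
equality. Conversely, a point of the `k`-th sector lies in the triangle spanned by `c` and the
vertices `k` and `k + 1`. -/
lemma convexHull_vertex (hN : 3 ≤ N) {R : ℝ} (hR : 0 < R) :
    convexHull ℝ (Set.range fun k : Fin N => vertex N θ R c (k : ℤ)) =
      closedPolygon N θ (R * Real.cos (Real.pi / N)) c := by
  have hN0 : 0 < N := by omega
  have hx := pi_div_pos hN
  have hx2 := pi_div_lt_pi_div_two hN
  refine subset_antisymm (convexHull_min ?_ convex_closedPolygon) fun x hxm => ?_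
  · rintro _ ⟨k, rfl⟩
    have hk : |θ + 2 * ((k : ℤ) : ℝ) * (Real.pi / N) - normalAngle N θ (k : ℤ)| ≤ Real.pi / N := by
      rw [normalAngle, abs_le]
      constructor <;> linarith
    refine (add_smul_mem_closedPolygon hN0 hR.le hk).2 (le_of_eq ?_)
    rw [normalAngle, ← Real.cos_neg]
    congr 2
    ring
  · obtain ⟨s, α, k, hs, hα, rfl⟩ := exists_polar hN0 θ c x
    rw [add_smul_mem_closedPolygon hN0 hs hα] at hxm
    set ψ := α - normalAngle N θ k with hψ
    have hsin : 0 < Real.sin (Real.pi / N) :=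
      Real.sin_pos_of_pos_of_lt_pi hx (by linarith [Real.pi_pos])
    have hcos : 0 < Real.cos (Real.pi / N) := cos_pos_of_abs_le hN (abs_of_pos hx).le
    obtain ⟨hα1, hα2⟩ := abs_le.1 hα
    have s1 : 0 ≤ Real.sin (Real.pi / N + ψ) :=
      Real.sin_nonneg_of_nonneg_of_le_pi (by linarith) (by linarith)
    have s2 : 0 ≤ Real.sin (Real.pi / N - ψ) :=
      Real.sin_nonneg_of_nonneg_of_le_pi (by linarith) (by linarith)
    -- `D = R sin(2π/N)`. The coefficients `a`, `b` solve the linear system by the sine rule, and `a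
    -- + b = s cos ψ / (R cos(π/N))`, which is at most `1` by the half plane condition.
    set D := R * (2 * Real.sin (Real.pi / N) * Real.cos (Real.pi / N)) with hD
    have hD0 : 0 < D := by positivity
    set a := s * Real.sin (Real.pi / N + ψ) / D with ha
    set b := s * Real.sin (Real.pi / N - ψ) / D with hb
    have ha0 : 0 ≤ a := by positivity
    have hb0 : 0 ≤ b := by positivity
    have hab : a + b ≤ 1 := by
      rw [ha, hb, ← add_div, div_le_one hD0, Real.sin_add (Real.pi / N) ψ,
        Real.sin_sub (Real.pi / N) ψ]
      nlinarith [mul_le_mul_of_nonneg_left hxm hsin.le]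
    have hmem : ∀ j : ℤ, vertex N θ R c j ∈
        convexHull ℝ (Set.range fun k : Fin N => vertex N θ R c (k : ℤ)) := by
      intro j
      obtain ⟨i, hi⟩ := exists_fin_vertex hN0 θ R c j
      rw [hi]
      exact subset_convexHull ℝ _ ⟨i, rfl⟩
    have e : c + s • unitVec α = a • vertex N θ R c (k + 1) + b • vertex N θ R c k
        + (1 - a - b) • c := by
      have ev : ∀ j, vertex N θ R c j = c + R • unitVec (θ + 2 * j * (Real.pi / N)) := fun _ => rfl
      have eα : α = normalAngle N θ k + ψ := by rw [hψ]; ring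
      have ea : θ + 2 * ((k + 1 : ℤ) : ℝ) * (Real.pi / N) = normalAngle N θ k + Real.pi / N := by
        rw [normalAngle]; push_cast; ring
      have eb : θ + 2 * (k : ℝ) * (Real.pi / N) = normalAngle N θ k - Real.pi / N := by
        rw [normalAngle]; ring
      have key : s • unitVec α = (a * R) • unitVec (normalAngle N θ k + Real.pi / N) +
          (b * R) • unitVec (normalAngle N θ k - Real.pi / N) := by
        rw [eα]
        have hsc := Real.sin_sq_add_cos_sq ψ
        ext i
        fin_cases i
        · simp [unitVec, ha, hb, hD, Real.sin_add, Real.sin_sub, Real.cos_add, Real.cos_sub]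
          field_simp
          ring
        · simp [unitVec, ha, hb, hD, Real.sin_add, Real.sin_sub, Real.cos_add, Real.cos_sub]
          field_simp
          ring
      rw [key, ev, ev, ea, eb]
      module
    rw [e]
    have hc := center_mem_convexHull_vertex hN θ R c
    have h3 := (convex_convexHull ℝ (Set.range fun k : Fin N => vertex N θ R c (k : ℤ))).sum_mem
      (t := Finset.univ) (w := ![a, b, 1 - a - b])
      (z := ![vertex N θ R c (k + 1), vertex N θ R c k, c])
      (by
        intro i _
        fin_cases i
        · exact ha0
        · exact hb0
        · simp; linarith)
      (by simp [Fin.sum_univ_three])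
      (by
        intro i _
        fin_cases i
        · exact hmem _
        · exact hmem _
        · exact hc)
    simpa [Fin.sum_univ_three] using h3

lemma IsRegularPolygon.exists_eq_openPolygon {S : Set Plane} (hN : 3 ≤ N)
    (h : IsRegularPolygon N c S) : ∃ θ r : ℝ, 0 < r ∧ S = openPolygon N θ r c := by
  obtain ⟨R, θ, hR, rfl⟩ := h
  have hcos : 0 < Real.cos (Real.pi / N) :=
    cos_pos_of_abs_le hN (abs_of_pos (pi_div_pos hN)).le
  refine ⟨θ, R * Real.cos (Real.pi / N), by positivity, ?_⟩
  rw [← interior_closedPolygon (by omega) (by positivity), ← convexHull_vertex hN hR]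
  congr 3
  ext1 k
  rw [vertex, unitVec]
  have : θ + 2 * Real.pi * (k : ℝ) / N = θ + 2 * ((k : ℤ) : ℝ) * (Real.pi / N) := by
    push_cast; ring
  rw [this]

end

/-! ### Arc length on the boundary and the identity for polygons. -/

section

variable {N : ℕ} {θ r : ℝ} {c : Plane}

/-- Arc length parametrization of the line through the `k`-th side of a regular polygon. -/
noncomputable def sideLine (N : ℕ) (θ r : ℝ) (c : Plane) (k : ℤ) (s : ℝ) : Plane :=
  c + r • unitVec (normalAngle N θ k) + s • unitVec (normalAngle N θ k + Real.pi / 2)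

lemma isometry_sideLine (k : ℤ) : Isometry (sideLine N θ r c k) := by
  refine Isometry.of_dist_eq fun s t => ?_
  rw [dist_eq_norm, sideLine, sideLine, add_sub_add_left_eq_sub, ← sub_smul, norm_smul,
    norm_unitVec, mul_one, Real.dist_eq, Real.norm_eq_abs]

lemma sideLine_tan (k : ℤ) {ψ : ℝ} (hψ : Real.cos ψ ≠ 0) :
    sideLine N θ r c k (r * Real.tan ψ) =
      c + (r / Real.cos ψ) • unitVec (normalAngle N θ k + ψ) := by
  rw [sideLine, add_assoc]
  congr 1
  rw [Real.tan_eq_sin_div_cos]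
  ext i
  fin_cases i
  · simp [unitVec, Real.cos_add]
    field_simp
    ring
  · simp [unitVec, Real.sin_add]
    field_simp

/-- The half length of the sides of a regular polygon with apothem `r`. -/
noncomputable def halfSide (N : ℕ) (r : ℝ) : ℝ := r * Real.tan (Real.pi / N)

lemma halfSide_pos (hN : 3 ≤ N) (hr : 0 < r) : 0 < halfSide N r :=
  mul_pos hr (Real.tan_pos_of_pos_of_lt_pi_div_two (pi_div_pos hN) (pi_div_lt_pi_div_two hN))

/-- The `k`-th closed side of a regular polygon. -/
def side (N : ℕ) (θ r : ℝ) (c : Plane) (k : ℤ) : Set Plane :=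
  sideLine N θ r c k '' Set.Icc (-halfSide N r) (halfSide N r)

lemma exists_tan_eq (hN : 3 ≤ N) (hr : 0 < r) {s : ℝ}
    (hs : s ∈ Set.Icc (-halfSide N r) (halfSide N r)) :
    ∃ ψ, |ψ| ≤ Real.pi / N ∧ s = r * Real.tan ψ := by
  have hx := pi_div_pos hN
  have hx2 := pi_div_lt_pi_div_two hN
  refine ⟨Real.arctan (s / r), abs_le.2 ⟨?_, ?_⟩, ?_⟩
  · rw [← Real.arctan_tan (x := -(Real.pi / N)) (by linarith) (by linarith), Real.tan_neg]
    refine Real.arctan_mono ?_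
    rw [le_div_iff₀ hr]
    have := hs.1
    rw [halfSide] at this
    linarith
  · rw [← Real.arctan_tan (x := Real.pi / N) (by linarith) (by linarith)]
    refine Real.arctan_mono ?_
    rw [div_le_iff₀ hr]
    have := hs.2
    rw [halfSide] at this
    linarith
  · rw [Real.tan_arctan]
    field_simp

lemma frontier_openPolygon_eq_iUnion (hN : 3 ≤ N) (hr : 0 < r) :
    frontier (openPolygon N θ r c) = ⋃ k : Fin N, side N θ r c (k : ℤ) := by
  have hN0 : 0 < N := by omega
  have hx := pi_div_pos hN
  have hx2 := pi_div_lt_pi_div_two hN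
  rw [frontier_openPolygon hN0 hr]
  ext x
  constructor
  · rintro ⟨h1, h2⟩
    obtain ⟨s, α, k, hs, hα, rfl⟩ := exists_polar hN0 θ c x
    have hc := cos_pos_of_abs_le hN hα
    rw [add_smul_mem_closedPolygon hN0 hs hα] at h1
    rw [add_smul_mem_openPolygon hN0 hs hα, not_lt] at h2
    have hsr : s = r / Real.cos (α - normalAngle N θ k) := by
      rw [eq_div_iff hc.ne']
      exact le_antisymm h1 h2
    obtain ⟨j, hj⟩ := exists_fin_unitVec_normalAngle hN0 θ k
    rw [Set.mem_iUnion]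
    refine ⟨j, r * Real.tan (α - normalAngle N θ k), ?_, ?_⟩
    · obtain ⟨ha, hb⟩ := abs_le.1 hα
      have hmono := Real.strictMonoOn_tan.monotoneOn
      constructor
      · rw [halfSide, ← mul_neg, ← Real.tan_neg]
        exact mul_le_mul_of_nonneg_left
          (hmono ⟨by linarith, by linarith⟩ ⟨by linarith, by linarith⟩ ha) hr.le
      · rw [halfSide]
        exact mul_le_mul_of_nonneg_left
          (hmono ⟨by linarith, by linarith⟩ ⟨by linarith, by linarith⟩ hb) hr.le
    · rw [sideLine_tan _ hc.ne', ← hsr]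
      congr 2
      -- The indices `j` and `k` may differ by a multiple of `N`: the normals agree as vectors, not
      -- as angles.
      have hcs : ∀ i, unitVec (normalAngle N θ j + (α - normalAngle N θ k)) i =
          unitVec (normalAngle N θ k + (α - normalAngle N θ k)) i := by
        have e0 : Real.cos (normalAngle N θ k) = Real.cos (normalAngle N θ j) := by
          simpa [unitVec] using congrArg (fun v : Plane => v 0) hj
        have e1 : Real.sin (normalAngle N θ k) = Real.sin (normalAngle N θ j) := by
          simpa [unitVec] using congrArg (fun v : Plane => v 1) hj
        intro i
        simp only [unitVec, Real.cos_add, Real.sin_add, e0, e1]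
      rw [PiLp.ext hcs]
      congr 1
      ring
  · intro hxm
    obtain ⟨k, s, hs, rfl⟩ := Set.mem_iUnion.1 hxm
    obtain ⟨ψ, hψ, rfl⟩ := exists_tan_eq hN hr hs
    have hc := cos_pos_of_abs_le hN hψ
    have hα : |normalAngle N θ k + ψ - normalAngle N θ k| ≤ Real.pi / N := by
      rwa [add_sub_cancel_left]
    have hpos : 0 ≤ r / Real.cos ψ := by positivity
    rw [sideLine_tan _ hc.ne', Set.mem_sdiff, add_smul_mem_closedPolygon hN0 hpos hα,
      add_smul_mem_openPolygon hN0 hpos hα, add_sub_cancel_left, div_mul_cancel₀ _ hc.ne']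
    simp

/-- Along side `j` the `k`-th constraint is affine in `s` with slope `-sin δ`, so `sin δ ≠ 0` leaves
one point. If `sin δ = 0`, a common point forces `cos δ = 1`, impossible for distinct normals. -/
lemma side_inter_subsingleton (hN : 3 ≤ N) (hr : 0 < r) {j k : Fin N} (hjk : j ≠ k) :
    (side N θ r c (j : ℤ) ∩ side N θ r c (k : ℤ)).Subsingleton := by
  have hN0 : 0 < N := by omega
  have hNr : (0 : ℝ) < N := by exact_mod_cast hN0
  have hx := pi_div_pos hN
  have hin : ∀ (i : Fin N) x, x ∈ side N θ r c (i : ℤ) →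
      inner ℝ (x - c) (unitVec (normalAngle N θ (i : ℤ))) = r := by
    rintro i _ ⟨s, -, rfl⟩
    have : sideLine N θ r c (i : ℤ) s - c = r • unitVec (normalAngle N θ (i : ℤ)) +
        s • unitVec (normalAngle N θ (i : ℤ) + Real.pi / 2) := by
      rw [sideLine]; abel
    rw [this, inner_add_left, real_inner_smul_left, real_inner_smul_left, inner_unitVec,
      inner_unitVec]
    simp
  rintro _ ⟨⟨s, -, rfl⟩, hx2⟩ _ ⟨⟨t, -, rfl⟩, hy2⟩
  have ha := hin k _ hx2
  have hb := hin k _ hy2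
  have e : ∀ s, inner ℝ (sideLine N θ r c (j : ℤ) s - c) (unitVec (normalAngle N θ (k : ℤ))) =
      r * Real.cos (normalAngle N θ (j : ℤ) - normalAngle N θ (k : ℤ)) -
      s * Real.sin (normalAngle N θ (j : ℤ) - normalAngle N θ (k : ℤ)) := by
    intro s
    have : sideLine N θ r c (j : ℤ) s - c = r • unitVec (normalAngle N θ (j : ℤ)) +
        s • unitVec (normalAngle N θ (j : ℤ) + Real.pi / 2) := by
      rw [sideLine]; abel
    rw [this, inner_add_left, real_inner_smul_left, real_inner_smul_left, inner_unitVec,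
      inner_unitVec, add_sub_right_comm, Real.cos_add_pi_div_two]
    ring
  rw [e] at ha hb
  have hd : normalAngle N θ (j : ℤ) - normalAngle N θ (k : ℤ) =
      2 * ((j : ℝ) - k) * (Real.pi / N) := by
    simp only [normalAngle]; push_cast; ring
  have hcos : Real.cos (normalAngle N θ (j : ℤ) - normalAngle N θ (k : ℤ)) ≠ 1 := by
    rw [hd]
    intro h
    have hj1 : (j : ℝ) + 1 ≤ N := by exact_mod_cast j.2
    have hk1 : (k : ℝ) + 1 ≤ N := by exact_mod_cast k.2
    have hj0 : (0 : ℝ) ≤ j := by positivity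
    have hk0 : (0 : ℝ) ≤ k := by positivity
    have hNx : N * (Real.pi / N) = Real.pi := by field_simp
    rw [Real.cos_eq_one_iff_of_lt_of_lt] at h
    · have : (j : ℝ) - k = 0 := by
        rcases mul_eq_zero.1 h with h | h
        · linarith
        · exact absurd h hx.ne'
      exact hjk (Fin.ext (by exact_mod_cast sub_eq_zero.1 this))
    · nlinarith
    · nlinarith
  set δ := normalAngle N θ (j : ℤ) - normalAngle N θ (k : ℤ)
  have hst : s = t ∨ Real.sin δ = 0 := by
    have : (s - t) * Real.sin δ = 0 := by linarith
    rcases mul_eq_zero.1 this with h | h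
    · exact Or.inl (sub_eq_zero.1 h)
    · exact Or.inr h
  rcases hst with rfl | h0
  · rfl
  · rw [h0, mul_zero, sub_zero] at ha
    exact absurd (mul_left_cancel₀ hr.ne' (ha.trans (mul_one r).symm)) hcos

lemma restrict_side (k : ℤ) : (Measure.hausdorffMeasure 1).restrict (side N θ r c k) =
    Measure.map (sideLine N θ r c k)
      (volume.restrict (Set.Icc (-halfSide N r) (halfSide N r))) := by
  have hi : Isometry (sideLine N θ r c k) := isometry_sideLine k
  have hm := hi.isClosedEmbedding.measurableEmbedding
  rw [← hausdorffMeasure_real]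
  conv_rhs => rw [← Set.preimage_image_eq (Set.Icc (-halfSide N r) (halfSide N r)) hi.injective]
  rw [← hm.restrict_map, hi.map_hausdorffMeasure (Or.inl zero_le_one),
    Measure.restrict_restrict_of_subset (Set.image_subset_range _ _), side]

lemma boundaryMeasure_openPolygon (hN : 3 ≤ N) (hr : 0 < r) :
    boundaryMeasure (openPolygon N θ r c) = ∑ k : Fin N,
      Measure.map (sideLine N θ r c (k : ℤ))
        (volume.restrict (Set.Icc (-halfSide N r) (halfSide N r))) := by
  have : NullSingletonClass (Measure.hausdorffMeasure 1 : Measure Plane) :=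
    Measure.nullSingletonClass_hausdorff Plane one_pos
  rw [boundaryMeasure, frontier_openPolygon_eq_iUnion hN hr, Measure.restrict_iUnion_ae]
  · rw [Measure.sum_fintype]
    simp only [restrict_side]
  · intro j k hjk
    exact (side_inter_subsingleton hN hr hjk).measure_zero _
  · intro k
    exact (isCompact_Icc.image
      (isometry_sideLine (k : ℤ)).continuous).isClosed.measurableSet.nullMeasurableSet

lemma boundaryMeasure_openPolygon_univ (hN : 3 ≤ N) (hr : 0 < r) :
    boundaryMeasure (openPolygon N θ r c) Set.univ = N * ENNReal.ofReal (2 * halfSide N r) := by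
  rw [boundaryMeasure_openPolygon hN hr, Measure.finsetSum_apply]
  have : ∀ k : Fin N, Measure.map (sideLine N θ r c (k : ℤ))
      (volume.restrict (Set.Icc (-halfSide N r) (halfSide N r))) Set.univ =
      ENNReal.ofReal (2 * halfSide N r) := by
    intro k
    rw [Measure.map_apply (isometry_sideLine (k : ℤ)).continuous.measurable MeasurableSet.univ]
    simp only [Set.preimage_univ, Measure.restrict_apply_univ, Real.volume_Icc]
    congr 1
    ring
  simp [this]

lemma isFiniteMeasure_boundaryMeasure_openPolygon (hN : 3 ≤ N) (hr : 0 < r) :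
    IsFiniteMeasure (boundaryMeasure (openPolygon N θ r c)) := by
  refine ⟨?_⟩
  rw [boundaryMeasure_openPolygon_univ hN hr]
  exact ENNReal.mul_lt_top (ENNReal.natCast_lt_top N) ENNReal.ofReal_lt_top

lemma boundaryMeasure_openPolygon_univ_ne_zero (hN : 3 ≤ N) (hr : 0 < r) :
    boundaryMeasure (openPolygon N θ r c) Set.univ ≠ 0 := by
  rw [boundaryMeasure_openPolygon_univ hN hr]
  have := halfSide_pos hN hr
  refine mul_ne_zero ?_ ?_
  · simp; omega
  · simp [this]

lemma integral_boundaryMeasure_openPolygon (hN : 3 ≤ N) (hr : 0 < r) {f : Plane → ℝ}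
    (hf : Continuous f) : ∫ x, f x ∂boundaryMeasure (openPolygon N θ r c) =
      ∑ k ∈ Finset.range N, ∫ s in (-halfSide N r)..(halfSide N r), f (sideLine N θ r c k s) := by
  have hh := halfSide_pos hN hr
  rw [boundaryMeasure_openPolygon hN hr, integral_finsetSum_measure]
  · rw [← Fin.sum_univ_eq_sum_range (fun k : ℕ =>
      ∫ s in (-halfSide N r)..(halfSide N r), f (sideLine N θ r c k s))]
    refine Finset.sum_congr rfl fun k _ => ?_
    rw [(isometry_sideLine (k : ℤ)).isClosedEmbedding.integral_map,
      intervalIntegral.integral_of_le (by linarith), integral_Icc_eq_integral_Ioc]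
  · intro k _
    rw [(isometry_sideLine (k : ℤ)).isClosedEmbedding.measurableEmbedding.integrable_map_iff]
    exact ((hf.comp (isometry_sideLine (k : ℤ)).continuous).continuousOn).integrableOn_Icc

/-- At angle `ψ` from the normal the ray leaves at distance `ρ = r / cos ψ`. With `s = r tan ψ` one
has `ρ² dψ = r ds`, which turns the angular integral into arc length. -/
lemma integral_rayIntegral_sector (hN : 3 ≤ N) (hr : 0 < r) {φ : Plane → ℝ}
    (hφ : ContDiff ℝ ∞ φ) (k : ℤ) :
    IntervalIntegrable (rayIntegral (openPolygon N θ r c) c φ) volume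
      (normalAngle N θ k - Real.pi / N) (normalAngle N θ k + Real.pi / N) ∧
    ∫ α in (normalAngle N θ k - Real.pi / N)..(normalAngle N θ k + Real.pi / N),
      rayIntegral (openPolygon N θ r c) c φ α =
    r * ∫ s in (-halfSide N r)..(halfSide N r), φ (sideLine N θ r c k s) := by
  have hx := pi_div_pos hN
  have hle : -(Real.pi / N) ≤ Real.pi / N := by linarith
  have hray : ∀ ψ, |ψ| ≤ Real.pi / N →
      rayIntegral (openPolygon N θ r c) c φ (normalAngle N θ k + ψ) =
      r * (φ (sideLine N θ r c k (r * Real.tan ψ)) * (r * (1 / Real.cos ψ ^ 2))) := by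
    intro ψ hψ
    have hc := cos_pos_of_abs_le hN hψ
    have hα : |normalAngle N θ k + ψ - normalAngle N θ k| ≤ Real.pi / N := by
      rwa [add_sub_cancel_left]
    rw [rayIntegral_eq hφ (ρ := r / Real.cos ψ) (by positivity), sideLine_tan _ hc.ne']
    · ring
    · intro s hs
      rw [add_smul_mem_openPolygon (by omega) hs.le hα, add_sub_cancel_left, lt_div_iff₀ hc]
  have hcont : ContinuousOn (fun ψ => r * (φ (sideLine N θ r c k (r * Real.tan ψ)) *
      (r * (1 / Real.cos ψ ^ 2)))) (Set.uIcc (-(Real.pi / N)) (Real.pi / N)) := by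
    have hcos : ∀ ψ ∈ Set.uIcc (-(Real.pi / N)) (Real.pi / N), Real.cos ψ ≠ 0 := by
      intro ψ hψ
      rw [Set.uIcc_of_le hle] at hψ
      exact (cos_pos_of_abs_le hN (abs_le.2 hψ)).ne'
    have ht : ContinuousOn Real.tan (Set.uIcc (-(Real.pi / N)) (Real.pi / N)) :=
      Real.continuousOn_tan.mono hcos
    have h1 : ContinuousOn (fun ψ => φ (sideLine N θ r c k (r * Real.tan ψ)))
        (Set.uIcc (-(Real.pi / N)) (Real.pi / N)) :=
      (hφ.continuous.comp (isometry_sideLine k).continuous).comp_continuousOn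
        (continuousOn_const.mul ht)
    refine continuousOn_const.mul (h1.mul (continuousOn_const.mul ?_))
    exact continuousOn_const.div (Real.continuous_cos.pow 2).continuousOn
      fun ψ hψ => pow_ne_zero 2 (hcos ψ hψ)
  have hEq : Set.EqOn (fun ψ => rayIntegral (openPolygon N θ r c) c φ (normalAngle N θ k + ψ))
      (fun ψ => r * (φ (sideLine N θ r c k (r * Real.tan ψ)) * (r * (1 / Real.cos ψ ^ 2))))
      (Set.uIcc (-(Real.pi / N)) (Real.pi / N)) := by
    intro ψ hψ
    rw [Set.uIcc_of_le hle] at hψ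
    exact hray ψ (abs_le.2 hψ)
  constructor
  · have h1 := (hcont.congr hEq).intervalIntegrable (μ := volume)
    have h2 := h1.comp_sub_right (normalAngle N θ k)
    simp only [add_sub_cancel] at h2
    convert h2 using 1 <;> ring
  · have e : ∫ α in (normalAngle N θ k - Real.pi / N)..(normalAngle N θ k + Real.pi / N),
        rayIntegral (openPolygon N θ r c) c φ α = ∫ ψ in (-(Real.pi / N))..(Real.pi / N),
        rayIntegral (openPolygon N θ r c) c φ (normalAngle N θ k + ψ) := by
      rw [intervalIntegral.integral_comp_add_left
        (fun α => rayIntegral (openPolygon N θ r c) c φ α)]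
      rfl
    rw [e, intervalIntegral.integral_congr hEq, intervalIntegral.integral_const_mul]
    congr 1
    have hsub := intervalIntegral.integral_comp_mul_deriv (a := -(Real.pi / N)) (b := Real.pi / N)
      (f := fun ψ => r * Real.tan ψ) (f' := fun ψ => r * (1 / Real.cos ψ ^ 2))
      (g := fun s => φ (sideLine N θ r c k s)) ?_ ?_
      (hφ.continuous.comp (isometry_sideLine k).continuous)
    · simp only [Function.comp_def] at hsub
      rw [hsub, Real.tan_neg, mul_neg]
      rfl
    · intro ψ hψ
      rw [Set.uIcc_of_le hle] at hψ
      exact (Real.hasDerivAt_tan (cos_pos_of_abs_le hN (abs_le.2 hψ)).ne').const_mul r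
    · refine continuousOn_const.mul (continuousOn_const.div
        (Real.continuous_cos.pow 2).continuousOn fun ψ hψ => pow_ne_zero 2 ?_)
      rw [Set.uIcc_of_le hle] at hψ
      exact (cos_pos_of_abs_le hN (abs_le.2 hψ)).ne'

theorem radialIdentity_openPolygon (hN : 3 ≤ N) (hr : 0 < r) :
    RadialIdentity (openPolygon N θ r c) c r := by
  intro φ hφ
  have hN0 : 0 < N := by omega
  have hNr : (0 : ℝ) < N := by exact_mod_cast hN0
  rw [integral_eq_integral_rayIntegral (isOpen_openPolygon hN0).measurableSet
    (isBounded_openPolygon hN) c hφ θ, integral_boundaryMeasure_openPolygon hN hr hφ.continuous,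
    Finset.mul_sum]
  let a : ℕ → ℝ := fun k => normalAngle N θ k - Real.pi / N
  have ha : ∀ k : ℕ, a (k + 1) = normalAngle N θ k + Real.pi / N := by
    intro k
    simp only [a, normalAngle]
    push_cast
    ring
  have h0 : a 0 = θ := by simp [a, normalAngle]
  have hN' : a N = θ + 2 * Real.pi := by
    simp only [a, normalAngle]
    push_cast
    field_simp
    ring
  have hsum := intervalIntegral.sum_integral_adjacent_intervals (a := a) (n := N) (μ := volume)
    (f := rayIntegral (openPolygon N θ r c) c φ) (fun k _ => by
      rw [ha]
      exact (integral_rayIntegral_sector hN hr hφ k).1)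
  rw [h0, hN'] at hsum
  rw [← hsum]
  refine Finset.sum_congr rfl fun k _ => ?_
  rw [ha]
  exact (integral_rayIntegral_sector hN hr hφ k).2

/-- The case `φ = 1`: twice the area is apothem times perimeter. -/
lemma volume_real_openPolygon (hN : 3 ≤ N) (hr : 0 < r) :
    volume.real (openPolygon N θ r c) = N * r ^ 2 * Real.tan (Real.pi / N) := by
  have h := radialIdentity_openPolygon (θ := θ) (c := c) hN hr (fun _ => 1) contDiff_const
  rw [integral_boundaryMeasure_openPolygon hN hr continuous_const] at h
  simp [gradient_fun_const, halfSide] at h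
  linarith

lemma norm_sideLine_sub_sq (k : ℤ) (s : ℝ) :
    ‖sideLine N θ r c k s - c‖ ^ 2 = r ^ 2 + s ^ 2 := by
  have : sideLine N θ r c k s - c = r • unitVec (normalAngle N θ k) +
      s • unitVec (normalAngle N θ k + Real.pi / 2) := by
    rw [sideLine]; abel
  rw [this, norm_add_sq_real, real_inner_smul_left, real_inner_smul_right, inner_unitVec]
  simp [norm_smul]

lemma integral_norm_sq_openPolygon (hN : 3 ≤ N) (hr : 0 < r) :
    ∫ x in openPolygon N θ r c, ‖x - c‖ ^ 2 =
      N * r ^ 4 * Real.tan (Real.pi / N) * (3 + Real.tan (Real.pi / N) ^ 2) / 6 := by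
  have hs : ContDiff ℝ ∞ fun x : Plane => ‖x - c‖ ^ 2 :=
    (contDiff_id.sub contDiff_const).norm_sq ℝ
  have h := radialIdentity_openPolygon (θ := θ) (c := c) hN hr _ hs
  simp only [inner_gradient_norm_sub_sq, integral_const_mul] at h
  rw [integral_boundaryMeasure_openPolygon hN hr hs.continuous] at h
  simp only [norm_sideLine_sub_sq] at h
  have hi : ∫ s in (-halfSide N r)..(halfSide N r), (r ^ 2 + s ^ 2) =
      2 * halfSide N r * r ^ 2 + 2 * halfSide N r ^ 3 / 3 := by
    rw [intervalIntegral.integral_add (by simp) (by simp)]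
    simp
    ring
  rw [hi] at h
  simp only [Finset.sum_const, Finset.card_range, nsmul_eq_mul, halfSide] at h
  nlinarith

theorem T_openPolygon (hN : 3 ≤ N) (hr : 0 < r)
    (hv : volume (openPolygon N θ r c) = ENNReal.ofReal Real.pi) :
    IsMinimizer (openPolygon N θ r c) (radialProfile (openPolygon N θ r c) c) ∧
      T (openPolygon N θ r c) = (polygonValue N : EReal) := by
  have := isFiniteMeasure_boundaryMeasure_openPolygon (θ := θ) (c := c) hN hr
  have ht := Real.tan_pos_of_pos_of_lt_pi_div_two (pi_div_pos hN) (pi_div_lt_pi_div_two hN)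
  have hNr : (0 : ℝ) < N := by exact_mod_cast (show 0 < N by omega)
  have h := (radialIdentity_openPolygon (θ := θ) (c := c) hN hr).T_eq
    (isOpen_openPolygon (by omega)).measurableSet (isBounded_openPolygon hN)
    (boundaryMeasure_openPolygon_univ_ne_zero hN hr)
  refine ⟨h.1, ?_⟩
  rw [h.2, integral_norm_sq_openPolygon hN hr, polygonValue]
  have hA := volume_real_openPolygon (θ := θ) (c := c) hN hr
  rw [measureReal_def, hv, ENNReal.toReal_ofReal Real.pi_pos.le] at hA
  congr 1
  rw [neg_mul, neg_inj, eq_div_iff (by positivity)]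
  -- Abstracting the tangent keeps its argument intact while `π = N r² t` is substituted.
  generalize Real.tan (Real.pi / N) = t at *
  rw [hA]
  ring

theorem T_regularPolygon {S : Set Plane} (hN : 3 ≤ N) (hS : IsRegularPolygon N c S)
    (hv : volume S = ENNReal.ofReal Real.pi) :
    IsMinimizer S (radialProfile S c) ∧ T S = (polygonValue N : EReal) := by
  obtain ⟨θ, r, hr, rfl⟩ := hS.exists_eq_openPolygon hN
  exact T_openPolygon hN hr hv

end

/-! ### The unit disk. -/

lemma lipschitzWith_unitVec : LipschitzWith 1 unitVec := by
  refine LipschitzWith.of_dist_le_mul fun a b => ?_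
  rw [NNReal.coe_one, one_mul, dist_eq_norm, Real.dist_eq]
  refine abs_le_of_sq_le_sq' ?_ (abs_nonneg _) |>.2
  rw [norm_sub_sq_real, inner_unitVec, norm_unitVec, norm_unitVec, sq_abs]
  have := Real.one_sub_sq_div_two_le_cos (x := a - b)
  linarith

lemma exists_unitVec_eq {x : Plane} (hx : ‖x‖ = 1) : ∃ α, unitVec α = x := by
  obtain ⟨α, hα⟩ := exists_eq_smul_unitVec x
  exact ⟨α, by rw [hα, hx, one_smul]⟩

lemma boundaryMeasure_ball :
    boundaryMeasure (Metric.ball 0 1) =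
      (Measure.hausdorffMeasure 1).restrict (Metric.sphere (0 : Plane) 1) := by
  rw [boundaryMeasure, frontier_ball _ one_ne_zero]

lemma isFiniteMeasure_boundaryMeasure_ball :
    IsFiniteMeasure (boundaryMeasure (Metric.ball 0 1)) := by
  rw [boundaryMeasure_ball, isFiniteMeasure_restrict]
  have hsub : Metric.sphere (0 : Plane) 1 ⊆ unitVec '' Set.Icc 0 (0 + 2 * Real.pi) := by
    rw [unitVec_periodic.image_Icc (by positivity)]
    intro x hx
    exact exists_unitVec_eq (by simpa using hx)
  have h := lipschitzWith_unitVec.hausdorffMeasure_image_le (d := 1) zero_le_one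
    (Set.Icc 0 (0 + 2 * Real.pi))
  rw [hausdorffMeasure_real, Real.volume_Icc] at h
  refine ((measure_mono hsub).trans_lt (h.trans_lt ?_)).ne
  exact ENNReal.mul_lt_top (by simp) ENNReal.ofReal_lt_top

/-- The first coordinate is `1`-Lipschitz and maps the circle onto `[-1, 1]`. -/
lemma boundaryMeasure_ball_univ_ne_zero :
    boundaryMeasure (Metric.ball 0 1) Set.univ ≠ 0 := by
  rw [boundaryMeasure_ball, Measure.restrict_apply_univ]
  have hl : LipschitzWith 1 (fun x : Plane => x 0) := by
    refine LipschitzWith.of_dist_le_mul fun x y => ?_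
    rw [NNReal.coe_one, one_mul, dist_eq_norm, dist_eq_norm]
    exact PiLp.norm_apply_le (x - y) 0
  have h := hl.hausdorffMeasure_image_le (d := 1) zero_le_one (Metric.sphere (0 : Plane) 1)
  have hsub : Set.Icc (-1) 1 ⊆ (fun x : Plane => x 0) '' Metric.sphere (0 : Plane) 1 := by
    intro t ht
    exact ⟨unitVec (Real.arccos t), by simp, by simp [unitVec, Real.cos_arccos ht.1 ht.2]⟩
  have h2 := (measure_mono hsub).trans h
  rw [hausdorffMeasure_real, Real.volume_Icc] at h2
  intro h0
  rw [h0] at h2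
  norm_num at h2

/-- Rotation by the angle `α`. -/
noncomputable def rotate (α : ℝ) (x : Plane) : Plane :=
  x 0 • unitVec α + x 1 • unitVec (α + Real.pi / 2)

lemma rotate_unitVec (α β : ℝ) : rotate α (unitVec β) = unitVec (α + β) := by
  ext i
  fin_cases i
  · simp [rotate, unitVec, Real.cos_add]
    ring
  · simp [rotate, unitVec, Real.sin_add]
    ring

lemma norm_rotate (α : ℝ) (x : Plane) : ‖rotate α x‖ = ‖x‖ := by
  obtain ⟨β, hβ⟩ := exists_eq_smul_unitVec x
  have : rotate α x = ‖x‖ • rotate α (unitVec β) := by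
    nth_rewrite 1 [hβ]
    simp only [rotate, PiLp.smul_apply, smul_eq_mul]
    module
  rw [this, rotate_unitVec, norm_smul, norm_unitVec, mul_one, norm_norm]

lemma isometry_rotate (α : ℝ) : Isometry (rotate α) := by
  refine Isometry.of_dist_eq fun x y => ?_
  rw [dist_eq_norm, dist_eq_norm, ← norm_rotate α (x - y)]
  congr 1
  simp only [rotate, PiLp.sub_apply]
  module

lemma surjective_rotate (α : ℝ) : Function.Surjective (rotate α) := by
  intro x
  obtain ⟨β, hβ⟩ := exists_eq_smul_unitVec x
  refine ⟨‖x‖ • unitVec (β - α), ?_⟩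
  have : rotate α (‖x‖ • unitVec (β - α)) = ‖x‖ • rotate α (unitVec (β - α)) := by
    simp only [rotate, PiLp.smul_apply, smul_eq_mul]
    module
  rw [this, rotate_unitVec, add_sub_cancel, ← hβ]

lemma continuous_rotate : Continuous fun p : ℝ × Plane => rotate p.1 p.2 := by
  have := continuous_unitVec
  unfold rotate
  fun_prop

lemma map_rotate_boundaryMeasure_ball (α : ℝ) :
    Measure.map (rotate α) (boundaryMeasure (Metric.ball 0 1)) =
      boundaryMeasure (Metric.ball 0 1) := by
  have hi := isometry_rotate α
  have hpre : rotate α ⁻¹' Metric.sphere (0 : Plane) 1 = Metric.sphere 0 1 := by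
    ext x
    simp [norm_rotate]
  rw [boundaryMeasure_ball]
  conv_lhs => rw [← hpre]
  rw [← hi.isClosedEmbedding.measurableEmbedding.restrict_map,
    hi.map_hausdorffMeasure (Or.inl zero_le_one), (surjective_rotate α).range_eq,
    Measure.restrict_univ]

/-- Averaging over rotations and exchanging the integrals shows that the invariant measure `σ` is
proportional to `dα`. The length of the circle need not be known. -/
lemma integral_unitVec_eq_boundaryMeasure_ball {φ : Plane → ℝ} (hφ : Continuous φ) :
    2 * Real.pi * ∫ x, φ x ∂boundaryMeasure (Metric.ball 0 1) =
      perimeter (Metric.ball 0 1) * ∫ α in 0..(2 * Real.pi), φ (unitVec α) := by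
  have := isFiniteMeasure_boundaryMeasure_ball
  have hmem : ∀ᵐ y ∂boundaryMeasure (Metric.ball 0 1), y ∈ Metric.sphere (0 : Plane) 1 := by
    rw [boundaryMeasure_ball]
    exact ae_restrict_mem Metric.isClosed_sphere.measurableSet
  have h1 : ∀ α, ∫ x, φ (rotate α x) ∂boundaryMeasure (Metric.ball 0 1) =
      ∫ x, φ x ∂boundaryMeasure (Metric.ball 0 1) := by
    intro α
    rw [← (isometry_rotate α).isClosedEmbedding.integral_map, map_rotate_boundaryMeasure_ball]
  have hp : Function.Periodic (fun α => φ (unitVec α)) (2 * Real.pi) := by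
    intro α
    simp only [unitVec_periodic α]
  have h2 : ∀ y ∈ Metric.sphere (0 : Plane) 1, ∫ α in 0..(2 * Real.pi), φ (rotate α y) =
      ∫ α in 0..(2 * Real.pi), φ (unitVec α) := by
    intro y hy
    obtain ⟨β, rfl⟩ := exists_unitVec_eq (x := y) (by simpa using hy)
    simp only [rotate_unitVec]
    rw [intervalIntegral.integral_comp_add_right (fun α => φ (unitVec α)), zero_add, add_comm,
      hp.intervalIntegral_add_eq β 0, zero_add]
  have hint : Integrable (Function.uncurry fun α y => φ (rotate α y))
      ((volume.restrict (Set.Ioc 0 (2 * Real.pi))).prod (boundaryMeasure (Metric.ball 0 1))) := by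
    obtain ⟨C, hC⟩ := ((isCompact_sphere (0 : Plane) 1).bddAbove_image
      (f := fun x => ‖φ x‖) hφ.norm.continuousOn)
    refine Integrable.of_bound (hφ.comp continuous_rotate).aestronglyMeasurable C ?_
    filter_upwards [Measure.quasiMeasurePreserving_snd.ae hmem] with p hp
    refine hC ⟨rotate p.1 p.2, ?_, rfl⟩
    simpa [norm_rotate] using hp
  have hswap := integral_integral_swap hint
  simp only [h1] at hswap
  rw [← intervalIntegral.integral_of_le (by positivity), intervalIntegral.integral_const] at hswap
  rw [sub_zero, smul_eq_mul] at hswap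
  rw [hswap, perimeter]
  have : ∫ y, (∫ α in Set.Ioc 0 (2 * Real.pi), φ (rotate α y))
      ∂boundaryMeasure (Metric.ball 0 1) = ∫ y, (∫ α in 0..(2 * Real.pi), φ (unitVec α))
      ∂boundaryMeasure (Metric.ball 0 1) := by
    refine integral_congr_ae ?_
    filter_upwards [hmem] with y hy
    rw [← h2 y hy, intervalIntegral.integral_of_le (by positivity)]
  rw [this, integral_const, smul_eq_mul]

lemma integral_ball_eq_integral_unitVec {φ : Plane → ℝ} (hφ : ContDiff ℝ ∞ φ) :
    ∫ x in Metric.ball (0 : Plane) 1, (inner ℝ (x - 0) (gradient φ x) + 2 * φ x) =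
      ∫ α in 0..(2 * Real.pi), φ (unitVec α) := by
  rw [integral_eq_integral_rayIntegral measurableSet_ball Metric.isBounded_ball 0 hφ 0, zero_add]
  refine intervalIntegral.integral_congr fun α _ => ?_
  rw [rayIntegral_eq hφ one_pos]
  · simp
  · intro s hs
    simp [norm_smul, abs_of_pos hs]

theorem radialIdentity_ball :
    RadialIdentity (Metric.ball 0 1) 0 (2 * Real.pi / perimeter (Metric.ball 0 1)) := by
  intro φ hφ
  have := isFiniteMeasure_boundaryMeasure_ball
  have hP : perimeter (Metric.ball 0 1) ≠ 0 := by
    rw [perimeter, measureReal_def]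
    exact ENNReal.toReal_ne_zero.2 ⟨boundaryMeasure_ball_univ_ne_zero, measure_ne_top _ _⟩
  have h := integral_unitVec_eq_boundaryMeasure_ball hφ.continuous
  rw [integral_ball_eq_integral_unitVec hφ, div_mul_eq_mul_div, h, mul_div_cancel_left₀ _ hP]

theorem T_ball : T (Metric.ball 0 1) = ((-(Real.pi / 16) : ℝ) : EReal) := by
  have := isFiniteMeasure_boundaryMeasure_ball
  rw [(radialIdentity_ball.T_eq measurableSet_ball Metric.isBounded_ball
    boundaryMeasure_ball_univ_ne_zero).2]
  have hs : ContDiff ℝ ∞ fun x : Plane => ‖x - 0‖ ^ 2 :=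
    (contDiff_id.sub contDiff_const).norm_sq ℝ
  -- This gives `4 ∫_B |x|² = 2π`.
  have h := integral_ball_eq_integral_unitVec hs
  simp only [inner_gradient_norm_sub_sq, integral_const_mul, sub_zero (unitVec _), norm_unitVec,
    one_pow, intervalIntegral.integral_const, smul_eq_mul] at h
  congr 1
  linarith

/-! ### Small Lipschitz deformations of the disk into polygons. -/

section

variable {N : ℕ} {r : ℝ}

/-- The support function of the outer normals of a regular `N`-gon. -/
noncomputable def normalSup (N : ℕ) (x : Plane) : ℝ :=
  ⨆ k : ℤ, inner ℝ x (unitVec (normalAngle N 0 k))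

lemma inner_le_normalSup (x : Plane) (k : ℤ) :
    inner ℝ x (unitVec (normalAngle N 0 k)) ≤ normalSup N x := by
  refine le_ciSup (f := fun k : ℤ => inner ℝ x (unitVec (normalAngle N 0 k))) ⟨‖x‖, ?_⟩ k
  rintro _ ⟨k, rfl⟩
  simpa using real_inner_le_norm x (unitVec (normalAngle N 0 k))

lemma normalSup_smul {t : ℝ} (ht : 0 ≤ t) (x : Plane) :
    normalSup N (t • x) = t * normalSup N x := by
  simp only [normalSup, real_inner_smul_left]
  exact (Real.mul_iSup_of_nonneg ht _).symm

lemma normalSup_le_norm (x : Plane) : normalSup N x ≤ ‖x‖ :=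
  ciSup_le fun k => by simpa using real_inner_le_norm x (unitVec (normalAngle N 0 k))

lemma exists_normalSup_eq (hN : 3 ≤ N) (x : Plane) : ∃ k : ℤ,
    normalSup N x = inner ℝ x (unitVec (normalAngle N 0 k)) ∧
    ‖x‖ * Real.cos (Real.pi / N) ≤ normalSup N x ∧
    (‖x‖ = 1 → ‖x - unitVec (normalAngle N 0 k)‖ ≤ Real.pi / N) := by
  obtain ⟨α, hα⟩ := exists_eq_smul_unitVec x
  obtain ⟨k, hk⟩ := exists_abs_sub_normalAngle_le (by omega : 0 < N) 0 α
  have hin : ∀ j : ℤ, inner ℝ x (unitVec (normalAngle N 0 j)) =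
      ‖x‖ * Real.cos (α - normalAngle N 0 j) := by
    intro j
    nth_rewrite 1 [hα]
    rw [real_inner_smul_left, inner_unitVec]
  have h1 : normalSup N x = inner ℝ x (unitVec (normalAngle N 0 k)) := by
    refine le_antisymm (ciSup_le fun j => ?_) (inner_le_normalSup x k)
    rw [hin, hin]
    exact mul_le_mul_of_nonneg_left (cos_sub_normalAngle_le (by omega) hk j) (norm_nonneg x)
  refine ⟨k, h1, ?_, fun hx => ?_⟩
  · rw [h1, hin]
    exact mul_le_mul_of_nonneg_left (cos_pi_div_le_cos hN hk) (norm_nonneg x)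
  · rw [hx, one_smul] at hα
    rw [hα]
    have := lipschitzWith_unitVec.dist_le_mul α (normalAngle N 0 k)
    rw [NNReal.coe_one, one_mul, dist_eq_norm, Real.dist_eq] at this
    exact this.trans hk

lemma half_le_cos_pi_div (hN : 3 ≤ N) : 1 / 2 ≤ Real.cos (Real.pi / N) := by
  have h3 : (3 : ℝ) ≤ N := by exact_mod_cast hN
  rw [← Real.cos_pi_div_three]
  exact Real.cos_le_cos_of_nonneg_of_le_pi (pi_div_pos hN).le
    (by linarith [Real.pi_pos]) (div_le_div_of_nonneg_left Real.pi_pos.le (by norm_num) h3)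

/-- On the unit circle the tangential slope of `normalSup` is the sine of the angle to the nearest
normal, at most of order `π/N`. -/
lemma normalSup_sub_le (hN : 3 ≤ N) {x y : Plane} (hx : ‖x‖ = 1) (hy : ‖y‖ = 1) :
    normalSup N x - normalSup N y ≤ 2 * (Real.pi / N) * ‖x - y‖ := by
  have hδ := pi_div_pos hN
  have h0 := norm_nonneg (x - y)
  obtain ⟨k, hk, -, hk1⟩ := exists_normalSup_eq hN x
  rcases le_or_gt ‖x - y‖ (Real.pi / N) with h | h
  -- For near points, `⟨x - y, x⟩ = ½ ‖x - y‖²` and the maximizing normal is within `π/N` of `x`;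
  -- together they give the factor `3/2 · π/N`.
  · have e : inner ℝ (x - y) (x + y) = 0 := by
      rw [inner_sub_left, inner_add_right, inner_add_right, real_inner_comm x y,
        real_inner_self_eq_norm_sq, real_inner_self_eq_norm_sq, hx, hy]
      ring
    have e2 : inner ℝ (x - y) (unitVec (normalAngle N 0 k)) =
        -inner ℝ (x - y) (x - unitVec (normalAngle N 0 k)) + (1 / 2) * ‖x - y‖ ^ 2 := by
      rw [← real_inner_self_eq_norm_sq]
      simp only [inner_sub_right, inner_add_right] at e ⊢
      linarith
    have h2 : normalSup N x - normalSup N y ≤ inner ℝ (x - y) (unitVec (normalAngle N 0 k)) := by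
      rw [hk, inner_sub_left]
      linarith [inner_le_normalSup (N := N) y k]
    have h3 := (abs_le.1 (abs_real_inner_le_norm (x - y) (x - unitVec (normalAngle N 0 k)))).1
    have h4 := mul_le_mul_of_nonneg_left (hk1 hx) h0
    nlinarith
  -- For far points, the total oscillation `1 - cos(π/N) ≤ (π/N)²/2` suffices.
  · obtain ⟨-, -, hj, -⟩ := exists_normalSup_eq hN y
    have h1 := normalSup_le_norm (N := N) x
    have h2 := Real.one_sub_sq_div_two_le_cos (x := Real.pi / N)
    rw [hx] at h1
    rw [hy, one_mul] at hj
    nlinarith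

lemma abs_normalSup_sub_le (hN : 3 ≤ N) {x y : Plane} (hx : ‖x‖ = 1) (hy : ‖y‖ = 1) :
    |normalSup N x - normalSup N y| ≤ 2 * (Real.pi / N) * ‖x - y‖ := by
  refine abs_le.2 ⟨?_, normalSup_sub_le hN hx hy⟩
  have := normalSup_sub_le hN hy hx
  rw [norm_sub_rev] at this
  linarith

lemma normalSup_pos (hN : 3 ≤ N) {x : Plane} (hx : x ≠ 0) : 0 < normalSup N x := by
  obtain ⟨-, -, h, -⟩ := exists_normalSup_eq hN x
  have := half_le_cos_pi_div hN
  exact (mul_pos (norm_pos_iff.2 hx) (by linarith)).trans_le h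

/-- The factor by which the disk is stretched in the direction of `x` to become the polygon with
apothem `r`. -/
noncomputable def stretch (N : ℕ) (r : ℝ) (x : Plane) : ℝ := r * ‖x‖ / normalSup N x

lemma stretch_smul {t : ℝ} (ht : 0 < t) (x : Plane) : stretch N r (t • x) = stretch N r x := by
  rw [stretch, stretch, normalSup_smul ht.le, norm_smul, Real.norm_of_nonneg ht.le,
    mul_left_comm, mul_div_mul_left _ _ ht.ne']

lemma abs_stretch_sub_one_le (hN : 3 ≤ N) (hr : 0 < r) {η : ℝ} (h1 : |r - 1| ≤ η)
    (h2 : |r / Real.cos (Real.pi / N) - 1| ≤ η) {x : Plane} (hx : x ≠ 0) :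
    |stretch N r x - 1| ≤ η := by
  obtain ⟨-, -, h, -⟩ := exists_normalSup_eq hN x
  have hm := normalSup_pos hN hx
  have hc := half_le_cos_pi_div hN
  have hc0 : 0 < Real.cos (Real.pi / N) := by linarith
  have hle := normalSup_le_norm (N := N) x
  have a1 : r ≤ stretch N r x := by
    rw [stretch, le_div_iff₀ hm]
    exact mul_le_mul_of_nonneg_left hle hr.le
  have a2 : stretch N r x ≤ r / Real.cos (Real.pi / N) := by
    rw [stretch, div_le_div_iff₀ hm hc0, mul_assoc]
    exact mul_le_mul_of_nonneg_left h hr.le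
  rw [abs_le] at *
  constructor <;> linarith

lemma abs_stretch_sub_le_of_norm_eq_one (hN : 3 ≤ N) (hr : 0 < r) {x y : Plane} (hx : ‖x‖ = 1)
    (hy : ‖y‖ = 1) :
    |stretch N r x - stretch N r y| ≤ 8 * r * (Real.pi / N) * ‖x - y‖ := by
  obtain ⟨-, -, h1, -⟩ := exists_normalSup_eq hN x
  obtain ⟨-, -, h2, -⟩ := exists_normalSup_eq hN y
  have hc := half_le_cos_pi_div hN
  have h := abs_normalSup_sub_le hN hy hx
  rw [hx, one_mul] at h1
  rw [hy, one_mul] at h2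
  have p1 : 0 < normalSup N x := by linarith
  have p2 : 0 < normalSup N y := by linarith
  have e : stretch N r x - stretch N r y =
      r * (normalSup N y - normalSup N x) / (normalSup N x * normalSup N y) := by
    rw [stretch, stretch, hx, hy]
    field_simp
  rw [e, abs_div, abs_mul, abs_of_pos hr, abs_of_pos (mul_pos p1 p2), div_le_iff₀ (mul_pos p1 p2)]
  rw [norm_sub_rev] at h
  have hK : 0 ≤ 2 * (Real.pi / N) * ‖x - y‖ := (abs_nonneg _).trans h
  have hmm : 1 / 4 ≤ normalSup N x * normalSup N y := by nlinarith
  calc r * |normalSup N y - normalSup N x| ≤ r * (2 * (Real.pi / N) * ‖x - y‖) :=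
        mul_le_mul_of_nonneg_left h hr.le
    _ = 4 * (r * (2 * (Real.pi / N) * ‖x - y‖)) * (1 / 4) := by ring
    _ ≤ 4 * (r * (2 * (Real.pi / N) * ‖x - y‖)) * (normalSup N x * normalSup N y) :=
        mul_le_mul_of_nonneg_left hmm (by positivity)
    _ = _ := by ring

/-- `stretch` is homogeneous of degree zero, so its Lipschitz bound degenerates at the origin; the
weight `‖y‖` compensates. Normalizing both points costs a factor `2`, hence `16` in place of `8`. -/
lemma abs_stretch_sub_mul_norm_le (hN : 3 ≤ N) (hr : 0 < r) {x y : Plane} (hx : x ≠ 0)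
    (hy : y ≠ 0) :
    |stretch N r x - stretch N r y| * ‖y‖ ≤ 16 * r * (Real.pi / N) * ‖x - y‖ := by
  have hx0 := norm_pos_iff.2 hx
  have hy0 := norm_pos_iff.2 hy
  have hδ := pi_div_pos hN
  have hx1 : ‖(‖x‖⁻¹ • x)‖ = 1 := by
    rw [norm_smul, norm_inv, norm_norm, inv_mul_cancel₀ hx0.ne']
  have hy1 : ‖(‖y‖⁻¹ • y)‖ = 1 := by
    rw [norm_smul, norm_inv, norm_norm, inv_mul_cancel₀ hy0.ne']
  have h := abs_stretch_sub_le_of_norm_eq_one hN hr hx1 hy1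
  rw [stretch_smul (inv_pos.2 hx0), stretch_smul (inv_pos.2 hy0)] at h
  have h2 : ‖(‖x‖⁻¹ • x) - (‖y‖⁻¹ • y)‖ * ‖y‖ ≤ 2 * ‖x - y‖ := by
    have e : ‖y‖ • ((‖x‖⁻¹ • x) - (‖y‖⁻¹ • y)) = (x - y) + (‖y‖ - ‖x‖) • (‖x‖⁻¹ • x) := by
      rw [smul_sub, smul_smul ‖y‖ ‖y‖⁻¹, mul_inv_cancel₀ hy0.ne', one_smul, sub_smul,
        smul_smul ‖x‖ ‖x‖⁻¹, mul_inv_cancel₀ hx0.ne', one_smul]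
      abel
    have h3 : ‖(‖x‖⁻¹ • x) - (‖y‖⁻¹ • y)‖ * ‖y‖ = ‖‖y‖ • ((‖x‖⁻¹ • x) - (‖y‖⁻¹ • y))‖ := by
      rw [norm_smul, norm_norm, mul_comm]
    rw [h3, e]
    refine (norm_add_le _ _).trans ?_
    rw [norm_smul, hx1, mul_one, Real.norm_eq_abs]
    have := abs_norm_sub_norm_le y x
    rw [norm_sub_rev y x] at this
    linarith
  calc |stretch N r x - stretch N r y| * ‖y‖
      ≤ 8 * r * (Real.pi / N) * ‖(‖x‖⁻¹ • x) - (‖y‖⁻¹ • y)‖ * ‖y‖ :=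
        mul_le_mul_of_nonneg_right h hy0.le
    _ = 8 * r * (Real.pi / N) * (‖(‖x‖⁻¹ • x) - (‖y‖⁻¹ • y)‖ * ‖y‖) := by ring
    _ ≤ 8 * r * (Real.pi / N) * (2 * ‖x - y‖) := mul_le_mul_of_nonneg_left h2 (by positivity)
    _ = _ := by ring

/-- The displacement field that moves the unit disk onto the polygon with apothem `r`. -/
noncomputable def displacement (N : ℕ) (r : ℝ) (x : Plane) : Plane := (stretch N r x - 1) • x

lemma norm_displacement_le (hN : 3 ≤ N) (hr : 0 < r) {η : ℝ} (h1 : |r - 1| ≤ η)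
    (h2 : |r / Real.cos (Real.pi / N) - 1| ≤ η) (x : Plane) :
    ‖displacement N r x‖ ≤ η * ‖x‖ := by
  rcases eq_or_ne x 0 with rfl | hx
  · simp [displacement]
  · rw [displacement, norm_smul, Real.norm_eq_abs]
    exact mul_le_mul_of_nonneg_right (abs_stretch_sub_one_le hN hr h1 h2 hx) (norm_nonneg x)

lemma norm_displacement_sub_le (hN : 3 ≤ N) (hr : 0 < r) {η : ℝ} (h1 : |r - 1| ≤ η)
    (h2 : |r / Real.cos (Real.pi / N) - 1| ≤ η) (x y : Plane) :
    ‖displacement N r x - displacement N r y‖ ≤ (η + 16 * r * (Real.pi / N)) * ‖x - y‖ := by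
  have hδ := pi_div_pos hN
  have h0 : 0 ≤ 16 * r * (Real.pi / N) := by positivity
  rcases eq_or_ne x 0 with rfl | hx
  · have := norm_displacement_le hN hr h1 h2 y
    simp only [displacement, smul_zero, zero_sub, norm_neg] at this ⊢
    exact this.trans (mul_le_mul_of_nonneg_right (by linarith) (norm_nonneg y))
  rcases eq_or_ne y 0 with rfl | hy
  · have := norm_displacement_le hN hr h1 h2 x
    simp only [displacement, smul_zero, sub_zero] at this ⊢
    exact this.trans (mul_le_mul_of_nonneg_right (by linarith) (norm_nonneg x))
  have e : displacement N r x - displacement N r y =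
      (stretch N r x - 1) • (x - y) + (stretch N r x - stretch N r y) • y := by
    simp only [displacement]; module
  rw [e]
  refine (norm_add_le _ _).trans ?_
  rw [norm_smul, norm_smul, Real.norm_eq_abs, Real.norm_eq_abs, add_mul]
  exact add_le_add (mul_le_mul_of_nonneg_right (abs_stretch_sub_one_le hN hr h1 h2 hx)
    (norm_nonneg _)) (abs_stretch_sub_mul_norm_le hN hr hx hy)

/-- The map satisfies `normalSup (stretch x • x) = r ‖x‖` off the origin, and the polygon is the set
where `normalSup` is below `r`. -/
lemma image_ball_add_displacement (hN : 3 ≤ N) (hr : 0 < r) :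
    (fun x => x + displacement N r x) '' Metric.ball 0 1 = openPolygon N 0 r 0 := by
  have e : ∀ x, x + displacement N r x = stretch N r x • x := by
    intro x; rw [displacement]; module
  simp only [e]
  ext y
  constructor
  · rintro ⟨x, hx, rfl⟩ k
    have hx1 : ‖x‖ < 1 := by simpa using hx
    rcases eq_or_ne x 0 with rfl | hx0
    · simpa using hr
    have hm := normalSup_pos hN hx0
    rw [sub_zero, real_inner_smul_left, stretch, div_mul_eq_mul_div, div_lt_iff₀ hm]
    have := inner_le_normalSup (N := N) x k
    have h1 : r * ‖x‖ * inner ℝ x (unitVec (normalAngle N 0 k)) ≤ r * ‖x‖ * normalSup N x :=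
      mul_le_mul_of_nonneg_left this (by positivity)
    nlinarith [mul_pos hr hm]
  · intro hy
    rcases eq_or_ne y 0 with rfl | hy0
    · exact ⟨0, by simp, by simp⟩
    have hm := normalSup_pos hN hy0
    have hn := norm_pos_iff.2 hy0
    have hlt : normalSup N y < r := by
      obtain ⟨k, hk, -⟩ := exists_normalSup_eq hN y
      have := hy k
      rw [sub_zero] at this
      rwa [hk]
    have ht : 0 < normalSup N y / (r * ‖y‖) := by positivity
    refine ⟨(normalSup N y / (r * ‖y‖)) • y, ?_, ?_⟩
    · rw [mem_ball_zero_iff, norm_smul, Real.norm_of_nonneg ht.le, div_mul_eq_mul_div,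
        mul_div_mul_right _ _ hn.ne', div_lt_one hr]
      exact hlt
    · simp only
      rw [stretch_smul ht, smul_smul, stretch]
      have : r * ‖y‖ / normalSup N y * (normalSup N y / (r * ‖y‖)) = 1 := by
        field_simp
      rw [this, one_smul]

/-- A Lipschitz retraction onto the closed unit ball. -/
noncomputable def ballRetraction (x : Plane) : Plane := (max 1 ‖x‖)⁻¹ • x

lemma norm_ballRetraction_le (x : Plane) : ‖ballRetraction x‖ ≤ 1 := by
  have h : 0 < max 1 ‖x‖ := lt_max_of_lt_left one_pos
  rw [ballRetraction, norm_smul, norm_inv, Real.norm_of_nonneg h.le, inv_mul_le_one₀ h]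
  exact le_max_right _ _

lemma ballRetraction_of_mem {x : Plane} (hx : x ∈ Metric.ball (0 : Plane) 1) :
    ballRetraction x = x := by
  have hx1 : ‖x‖ < 1 := by simpa using hx
  rw [ballRetraction, max_eq_left hx1.le, inv_one, one_smul]

lemma norm_ballRetraction_sub_le (x y : Plane) :
    ‖ballRetraction x - ballRetraction y‖ ≤ 2 * ‖x - y‖ := by
  have hX : 0 < max 1 ‖x‖ := lt_max_of_lt_left one_pos
  have hY : 0 < max 1 ‖y‖ := lt_max_of_lt_left one_pos
  have e : ballRetraction x - ballRetraction y =
      (max 1 ‖x‖)⁻¹ • ((x - y) + (max 1 ‖y‖ - max 1 ‖x‖) • ballRetraction y) := by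
    have h : (max 1 ‖x‖)⁻¹ * (max 1 ‖y‖ - max 1 ‖x‖) * (max 1 ‖y‖)⁻¹ =
        (max 1 ‖x‖)⁻¹ - (max 1 ‖y‖)⁻¹ := by
      field_simp
    rw [ballRetraction, ballRetraction, smul_add, smul_smul, smul_smul, h]
    module
  rw [e, norm_smul, norm_inv, Real.norm_of_nonneg hX.le]
  have h1 : (max 1 ‖x‖)⁻¹ ≤ 1 := inv_le_one_of_one_le₀ (le_max_left _ _)
  have h2 : ‖(x - y) + (max 1 ‖y‖ - max 1 ‖x‖) • ballRetraction y‖ ≤ 2 * ‖x - y‖ := by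
    refine (norm_add_le _ _).trans ?_
    rw [norm_smul, Real.norm_eq_abs]
    have h3 : |max 1 ‖y‖ - max 1 ‖x‖| ≤ ‖x - y‖ := by
      refine (abs_max_sub_max_le_max 1 ‖y‖ 1 ‖x‖).trans ?_
      rw [sub_self, abs_zero, max_eq_right (abs_nonneg _), norm_sub_rev]
      exact abs_norm_sub_norm_le y x
    have h4 := mul_le_mul h3 (norm_ballRetraction_le y) (norm_nonneg _) (norm_nonneg _)
    linarith
  calc _ ≤ 1 * ‖(x - y) + (max 1 ‖y‖ - max 1 ‖x‖) • ballRetraction y‖ :=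
        mul_le_mul_of_nonneg_right h1 (norm_nonneg _)
    _ ≤ _ := by rwa [one_mul]

/-- The apothem of the regular `N`-gon of area `π`. -/
noncomputable def apothem (N : ℕ) : ℝ := √((Real.pi / N) / Real.tan (Real.pi / N))

lemma apothem_pos (hN : 3 ≤ N) : 0 < apothem N :=
  Real.sqrt_pos.2 (div_pos (pi_div_pos hN)
    (Real.tan_pos_of_pos_of_lt_pi_div_two (pi_div_pos hN) (pi_div_lt_pi_div_two hN)))

lemma tendsto_apothem : Tendsto apothem atTop (𝓝 1) := by
  have h := ((tendsto_tan_div.comp pi_div_tendsto).inv₀ one_ne_zero).sqrt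
  rw [inv_one, Real.sqrt_one] at h
  refine h.congr fun N => ?_
  simp [apothem]

lemma volume_openPolygon_apothem (hN : 3 ≤ N) :
    volume (openPolygon N 0 (apothem N) 0) = ENNReal.ofReal Real.pi := by
  have ht := Real.tan_pos_of_pos_of_lt_pi_div_two (pi_div_pos hN) (pi_div_lt_pi_div_two hN)
  have hNr : (0 : ℝ) < N := by exact_mod_cast (show 0 < N by omega)
  have hx := pi_div_pos hN
  rw [← ENNReal.ofReal_toReal (isBounded_openPolygon hN).measure_lt_top.ne, ← measureReal_def,
    volume_real_openPolygon hN (apothem_pos hN), apothem, Real.sq_sqrt (by positivity)]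
  congr 1
  field_simp

theorem not_isLipschitzLocalMinimizer_T_ball :
    ¬ IsLipschitzLocalMinimizer T (Metric.ball 0 1) := by
  rintro ⟨ε, hε, H⟩
  have hε' : (0 : ℝ) < ε := hε
  -- With `r ≤ 2` and `π/N ≤ η` the displacement has Lipschitz constant at most `η + 32 η`; the
  -- retraction doubles this to `66 η`.
  set η : ℝ := min 1 (ε / 66) with hη
  have hη0 : 0 < η := by positivity
  have hη1 : η ≤ 1 := min_le_left _ _
  have hη2 : 66 * η ≤ ε := by
    have := min_le_right 1 ((ε : ℝ) / 66)
    linarith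
  have hx0 : Tendsto (fun N : ℕ => Real.pi / N) atTop (𝓝 0) :=
    tendsto_const_div_atTop_nhds_zero_nat _
  have hcos : Tendsto (fun N : ℕ => Real.cos (Real.pi / N)) atTop (𝓝 1) := by
    have := (Real.continuous_cos.tendsto 0).comp hx0
    rwa [Real.cos_zero] at this
  have hq : Tendsto (fun N : ℕ => apothem N / Real.cos (Real.pi / N)) atTop (𝓝 1) := by
    have := tendsto_apothem.div hcos one_ne_zero
    rwa [div_one] at this
  obtain ⟨N, hN, hN1, hN2, hN3⟩ := ((eventually_ge_atTop 3).and
    ((tendsto_apothem.eventually (Metric.closedBall_mem_nhds 1 hη0)).and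
    ((hq.eventually (Metric.closedBall_mem_nhds 1 hη0)).and
    (hx0.eventually (Iic_mem_nhds hη0))))).exists
  have h1 : |apothem N - 1| ≤ η := by simpa [Real.dist_eq] using hN1
  have h2 : |apothem N / Real.cos (Real.pi / N) - 1| ≤ η := by simpa [Real.dist_eq] using hN2
  have h3 : Real.pi / N ≤ η := hN3
  have hr := apothem_pos hN
  have hr2 : apothem N ≤ 2 := by linarith [(abs_le.1 h1).2]
  have hδ := pi_div_pos hN
  have hK : η + 16 * apothem N * (Real.pi / N) ≤ 33 * η := by nlinarith
  -- The displacement grows linearly. Composing it with the retraction bounds it on the whole plane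
  -- and changes nothing on the disk.
  have himg : (fun x => x + displacement N (apothem N) (ballRetraction x)) '' Metric.ball 0 1 =
      openPolygon N 0 (apothem N) 0 := by
    rw [← image_ball_add_displacement hN hr]
    exact Set.image_congr fun x hx => by rw [ballRetraction_of_mem hx]
  have hle := H (fun x => displacement N (apothem N) (ballRetraction x)) ?_ ?_ ?_
  · rw [himg, (T_openPolygon hN hr (volume_openPolygon_apothem hN)).2, T_ball,
      EReal.coe_le_coe_iff] at hle
    exact absurd (polygonValue_lt hN) (not_lt.2 hle)
  · refine LipschitzWith.of_dist_le_mul fun x y => ?_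
    rw [dist_eq_norm, dist_eq_norm]
    refine (norm_displacement_sub_le hN hr h1 h2 _ _).trans ?_
    calc _ ≤ 33 * η * (2 * ‖x - y‖) :=
          mul_le_mul hK (norm_ballRetraction_sub_le x y) (norm_nonneg _) (by positivity)
      _ = 66 * η * ‖x - y‖ := by ring
      _ ≤ _ := mul_le_mul_of_nonneg_right hη2 (norm_nonneg _)
  · intro x
    refine (norm_displacement_le hN hr h1 h2 _).trans ?_
    have := mul_le_mul_of_nonneg_left (norm_ballRetraction_le x) hη0.le
    linarith
  · rw [himg, volume_openPolygon_apothem hN, EuclideanSpace.volume_ball_fin_two]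
    simp

end

end BoundaryMeanTorsion

/-! ### Assembly of the six claims. -/

theorem mainTheorem3
    (P : ℕ → Set BoundaryMeanTorsion.Plane) (c : ℕ → BoundaryMeanTorsion.Plane)
    (hP : ∀ N, 3 ≤ N → BoundaryMeanTorsion.IsRegularPolygon N (c N) (P N))
    (harea : ∀ N, 3 ≤ N → volume (P N) = ENNReal.ofReal Real.pi) :
    StrictMonoOn (fun N => BoundaryMeanTorsion.T (P N)) (Set.Ici 3) ∧
    Tendsto (fun N => BoundaryMeanTorsion.T (P N)) atTop
      (𝓝 (BoundaryMeanTorsion.T (Metric.ball 0 1))) ∧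
    (∀ N, 3 ≤ N → BoundaryMeanTorsion.T (P N) < BoundaryMeanTorsion.T (Metric.ball 0 1)) ∧
    ¬ BoundaryMeanTorsion.IsLipschitzLocalMinimizer BoundaryMeanTorsion.T (Metric.ball 0 1) ∧
    (∀ N, 3 ≤ N → BoundaryMeanTorsion.IsMinimizer (P N) (fun x =>
      (1 / (4 * BoundaryMeanTorsion.perimeter (P N))) *
          (∫ y, ‖y - c N‖ ^ 2 ∂(BoundaryMeanTorsion.boundaryMeasure (P N)))
        - ‖x - c N‖ ^ 2 / 4)) ∧
    (∀ N : ℕ, 3 ≤ N → BoundaryMeanTorsion.T (P N) =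
      ((-(Real.pi ^ 2 * (3 + Real.tan (Real.pi / N) ^ 2) /
        (48 * N * Real.tan (Real.pi / N))) : ℝ) : EReal)) := by
  have hT : ∀ N, 3 ≤ N → BoundaryMeanTorsion.T (P N) =
      (BoundaryMeanTorsion.polygonValue N : EReal) := fun N hN =>
    (BoundaryMeanTorsion.T_regularPolygon hN (hP N hN) (harea N hN)).2
  refine ⟨fun a ha b hb hab => ?_, ?_, fun N hN => ?_,
    BoundaryMeanTorsion.not_isLipschitzLocalMinimizer_T_ball, fun N hN =>
    (BoundaryMeanTorsion.T_regularPolygon hN (hP N hN) (harea N hN)).1, hT⟩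
  · simp only [hT a ha, hT b hb]
    exact EReal.coe_lt_coe_iff.2 (BoundaryMeanTorsion.polygonValue_strictMonoOn ha hb hab)
  · rw [BoundaryMeanTorsion.T_ball]
    -- Nothing is assumed about `P N` for `N < 3`, so the values agree only eventually.
    refine Tendsto.congr' ?_ ((continuous_coe_real_ereal.tendsto _).comp
      BoundaryMeanTorsion.tendsto_polygonValue)
    filter_upwards [eventually_ge_atTop 3] with N hN
    exact (hT N hN).symm
  · rw [hT N hN, BoundaryMeanTorsion.T_ball]
    exact EReal.coe_lt_coe_iff.2 (BoundaryMeanTorsion.polygonValue_lt hN)
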